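/- **Definitions.** An *involutory set* $(K,K_0,\sigma)$ consists of a skew-field $K$, an involution $\sigma$ of $K$ (an anti-automorphism with $\sigma^2=\mathrm{id}$) and an additive subgroup $K_0\subseteq K$ with $1\in K_0$, $\{a+a^\sigma\mid a\in K\}\subseteq K_0\subseteq \mathrm{Fix}(\sigma)$ and $a^\sigma K_0a\subseteq K_0$ for all $a\in K$. It is *proper* if $\sigma\neq\mathrm{id}$ and $K_0$ generates $K$ as a ring. It is *quadratic of type (iii)* if $K$ is commutative, $K_0$ is a subfield, $K/K_0$ is a separable quadratic extension and $\langle\sigma\rangle=\mathrm{Gal}(K/K_0)$; it is *quadratic of type (iv)* if $K$ is a quaternion division algebra over its center, $K_0=Z(K)$ and $\sigma$ is the standard involution. A *pseudo-quadratic space* $\Xi=(K,K_0,\sigma,L_0,q)$ consists of an involutory set $(K,K_0,\sigma)$, a right $K$-vector space $L_0$ and a map $q:L_0\to K$ for which there is a skew-hermitian form $f$ on $L_0$ (biadditive, $f(as,bt)=s^\sigma f(a,b)t$, $f(a,b)^\sigma=-f(b,a)$) with $q(a+b)\equiv q(a)+q(b)+f(a,b)$ and $q(at)\equiv t^\sigma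 q(a)t \pmod{K_0}$, and with $q(a)\in K_0\Leftrightarrow a=0$. It is *proper* if $\sigma\ne\mathrm{id}$, $L_0\neq 0$ and $f$ (which is then unique) is non-degenerate. Its group is $T=\{(a,t)\in L_0\times K\mid q(a)-t\in K_0\}$ with $(a,t)(b,v)=(a+b,\,t+v+f(b,a))$. An *isomorphism* $\Phi=(\varphi,\phi):\Xi\to\tilde\Xi$ consists of a group isomorphism $\varphi:L_0\to\tilde L_0$ and an isomorphism of skew-fields $\phi:K\to\tilde K$ with $\varphi(at)=\varphi(a)\phi(t)$, $\phi(K_0)=\tilde K_0$, $\phi\circ\sigma=\tilde\sigma\circ\phi$ and $\phi(q(a))\equiv\tilde q(\varphi(a))\pmod{\tilde K_0}$. It *induces* $\gamma:T\to\tilde T$ if $\gamma(a,t)=(\varphi(a),\phi(t))$ for all $(a,t)\in T$. For proper $\Xi,\tilde\Xi$, a *Jordan isomorphism* $\gamma:T\to\tilde T$ is a group isomorphism with $\gamma(0,1)=(0,1)$ and $\gamma(h_{(a,t)}(b,v))=\tilde h_{\gamma(a,t)}(\gamma(b,v))$ for all $(a,t),(b,v)\in T$, where $h_{(a,t)}(b,v)=(bt^\sigma-at^{-1}f(a,b)t^\sigma,\;tvt^\sigma)$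 (and $h_{(0,0)}(b,v)=(0,0)$). **Theorem.** Let $\Xi=(K,K_0,\sigma,L_0,q)$ and $\tilde\Xi=(\tilde K,\tilde K_0,\tilde\sigma,\tilde L_0,\tilde q)$ be proper pseudo-quadratic spaces, let $\gamma:T\to\tilde T$ be a Jordan isomorphism, and suppose that one of the following holds: (i) $(K,K_0,\sigma)$ is proper; (ii) $(K,K_0,\sigma)$ is quadratic of type (iii) or (iv) and $\dim_KL_0\ge3$; (iii) $(K,K_0,\sigma)$ is quadratic of type (iii) or (iv), $\dim_KL_0\le2$, $K\not\cong\mathbb F_4$, and there is an isomorphism of skew-fields $\psi:K\to\tilde K$, where, if $(K,K_0,\sigma)$ is of type (iv) and $\dim_KL_0=2$, the isomorphism $\psi$ is required to be compatible with the identification of the centers given by $\gamma$, i.e. $\gamma(0,t)=(0,\psi(t))$ for all $t\in K_0=Z(K)$. Then $\gamma$ is induced by an isomorphism $\Phi:\Xi\to\tilde\Xi$ of pseudo-quadratic spaces. -/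

import Mathlib

open MulOpposite

/-- An involutory set `(K, K₀, σ)`: `K` is a skew-field, the involution `σ` is the `star` of `K`,
and `K₀` is an additive subgroup with `1 ∈ K₀`, `{a + a^σ} ⊆ K₀ ⊆ Fix σ` and `a^σ K₀ a ⊆ K₀`. -/
structure InvolutorySet (K : Type*) [DivisionRing K] [StarRing K] where
  K₀ : AddSubgroup K
  one_mem : (1 : K) ∈ K₀
  add_star_mem : ∀ a : K, a + star a ∈ K₀
  star_eq : ∀ t ∈ K₀, star t = t
  conj_mem : ∀ a : K, ∀ t ∈ K₀, star a * t * a ∈ K₀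

namespace InvolutorySet

variable {K : Type*} [DivisionRing K] [StarRing K]

/-- `σ ≠ id` and `K₀` generates `K` as a ring. -/
def IsProperInvolutorySet (S : InvolutorySet K) : Prop :=
  (∃ x : K, star x ≠ x) ∧ Subring.closure (S.K₀ : Set K) = ⊤

/-- Quadratic of type (iii): `K` is commutative, `K₀` is (the underlying set of) a subfield `F` of
`K`, `K / F` is a separable quadratic extension, and `σ` generates `Gal(K / F)`. -/
def IsQuadraticOfTypeIII (S : InvolutorySet K) : Prop :=
  ∃ hcomm : ∀ x y : K, x * y = y * x,
    letI : Field K := { ‹DivisionRing K› with mul_comm := hcomm }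
    ∃ F : Subfield K, (F : Set K) = (S.K₀ : Set K) ∧
      Algebra.IsSeparable F K ∧ Module.finrank F K = 2 ∧
      ∃ s : K ≃ₐ[F] K, (∀ x, s x = star x) ∧ Subgroup.zpowers s = ⊤

/-- Quadratic of type (iv): `K` is a quaternion (division) algebra over its center `Z`, `K₀ = Z`,
and `σ` is the standard involution. Mathlib's `QuaternionAlgebra Z a b c` is
`Z[i] ⊕ Z[i] j` with `i² = a + b i`, `j² = c`, `j i = (b - i) j`, and its `star` is the standard
involution; `b² + 4 a ≠ 0` says that `X² - b X - a` is separable. -/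
def IsQuadraticOfTypeIV (S : InvolutorySet K) : Prop :=
  (S.K₀ : Set K) = Set.center K ∧
    ∃ a b c : Subring.center K, b ^ 2 + 4 * a ≠ 0 ∧
      ∃ e : QuaternionAlgebra (Subring.center K) a b c ≃ₐ[Subring.center K] K,
        ∀ x, e (star x) = star (e x)

end InvolutorySet

/-- An (anisotropic, right) pseudo-quadratic space `(K, K₀, σ, L, q)` with associated
skew-hermitian form `f`. The right scalar multiplication `a · t` is `op t • a`. By `form_unique`
below, `f` is determined by `q` as soon as `σ ≠ id`. -/
structure PseudoQuadraticSpace (K L : Type*) [DivisionRing K] [StarRing K] [AddCommGroup L]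
    [Module Kᵐᵒᵖ L] extends InvolutorySet K where
  q : L → K
  f : L → L → K
  f_add_left : ∀ a b c, f (a + b) c = f a c + f b c
  f_add_right : ∀ a b c, f a (b + c) = f a b + f a c
  f_smul_smul : ∀ a b (s t : K), f (op s • a) (op t • b) = star s * f a b * t
  star_f : ∀ a b, star (f a b) = - f b a
  q_add : ∀ a b, q (a + b) - (q a + q b + f a b) ∈ K₀
  q_smul : ∀ a (t : K), q (op t • a) - star t * q a * t ∈ K₀
  q_mem_iff : ∀ a, q a ∈ K₀ ↔ a = 0

namespace PseudoQuadraticSpace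

variable {K L : Type*} [DivisionRing K] [StarRing K] [AddCommGroup L] [Module Kᵐᵒᵖ L]

/-- `σ ≠ id`, `L ≠ 0` and the associated skew-hermitian form is non-degenerate. -/
structure IsProper (X : PseudoQuadraticSpace K L) : Prop where
  star_ne : ∃ x : K, star x ≠ x
  nontrivial : Nontrivial L
  nondegenerate : ∀ a, (∀ b, X.f a b = 0) → a = 0

variable (X : PseudoQuadraticSpace K L)

theorem f_smul_left (a b : L) (s : K) : X.f (op s • a) b = star s * X.f a b := by
  simpa using X.f_smul_smul a b s 1

theorem f_smul_right (a b : L) (t : K) : X.f a (op t • b) = X.f a b * t := by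
  simpa using X.f_smul_smul a b 1 t

theorem f_zero_left (a : L) : X.f 0 a = 0 := by
  simpa using X.f_add_left 0 0 a

theorem f_zero_right (a : L) : X.f a 0 = 0 := by
  simpa using X.f_add_right a 0 0

theorem f_neg_left (a b : L) : X.f (-a) b = -X.f a b := by
  have h := X.f_add_left (-a) a b
  rw [neg_add_cancel, f_zero_left] at h
  exact eq_neg_of_add_eq_zero_left h.symm

theorem f_neg_right (a b : L) : X.f a (-b) = -X.f a b := by
  have h := X.f_add_right a (-b) b
  rw [neg_add_cancel, f_zero_right] at h
  exact eq_neg_of_add_eq_zero_left h.symm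

theorem q_zero_mem : X.q 0 ∈ X.K₀ := (X.q_mem_iff 0).2 rfl

/-- If `K₀ ≠ K`, then `K₀` contains no nonzero right ideal of `K`. -/
theorem eq_zero_of_forall_mem {x : K} (h : ∀ t, x * t ∈ X.K₀) (hK : ∃ y, y ∉ X.K₀) : x = 0 := by
  by_contra hx
  obtain ⟨y, hy⟩ := hK
  exact hy (by simpa [mul_inv_cancel_left₀ hx] using h (x⁻¹ * y))

/-- The skew-hermitian form of a pseudo-quadratic space with `σ ≠ id` is determined by `q`. -/
theorem form_unique (Y : PseudoQuadraticSpace K L) (hS : X.K₀ = Y.K₀) (hq : X.q = Y.q)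
    (hσ : ∃ x : K, star x ≠ x) : X.f = Y.f := by
  funext a b
  obtain ⟨y, hy⟩ := hσ
  refine sub_eq_zero.1 (X.eq_zero_of_forall_mem (fun t => ?_) ⟨y, fun h => hy (X.star_eq y h)⟩)
  have h1 := X.q_add a (op t • b)
  have h2 := Y.q_add a (op t • b)
  rw [← hS, ← hq] at h2
  have h3 := X.K₀.sub_mem h2 h1
  rw [f_smul_right] at h3
  rw [f_smul_right] at h3
  convert h3 using 1
  noncomm_ring

/-- `f(a, a) = q(a) - q(a)^σ`. -/
theorem f_self (a : L) : X.f a a = X.q a - star (X.q a) := by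
  by_cases hK : ∃ y, y ∉ X.K₀
  · have key : X.f a a - X.q a + star (X.q a) = 0 := by
      refine X.eq_zero_of_forall_mem (fun t => ?_) hK
      have h1 := X.q_add a (op t • a)
      have h2 := X.q_smul a (1 + t)
      have h3 := X.q_smul a t
      have h4 := X.add_star_mem (star t * X.q a)
      have e : op (1 + t) • a = a + op t • a := by simp [add_smul]
      rw [e] at h2
      rw [f_smul_right] at h1
      have h5 := X.K₀.sub_mem (X.K₀.add_mem (X.K₀.sub_mem h2 h1) h4) h3
      convert h5 using 1
      simp only [star_add, star_one, star_mul, star_star]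
      noncomm_ring
    have : X.f a a = X.f a a - X.q a + star (X.q a) + (X.q a - star (X.q a)) := by abel
    rw [this, key, zero_add]
  · push Not at hK
    have ha : a = 0 := (X.q_mem_iff a).1 (hK _)
    subst ha
    rw [X.star_eq _ (hK _), f_zero_left, sub_self]

/-- The set `T = {(a, t) ∈ L × K | q(a) - t ∈ K₀}`. -/
@[ext]
structure T where
  vec : L
  scal : K
  mem : X.q vec - scal ∈ X.K₀

variable {X}

/-- `f(a, a) = t - t^σ` for `(a, t) ∈ T`. -/
theorem T.f_self (x : X.T) : X.f x.vec x.vec = x.scal - star x.scal := by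
  have h := X.star_eq _ x.mem
  rw [star_sub] at h
  rw [X.f_self]
  have e : X.q x.vec - star (X.q x.vec) - (x.scal - star x.scal) = 0 := by
    have : X.q x.vec - star (X.q x.vec) - (x.scal - star x.scal) =
      (X.q x.vec - x.scal) - (star (X.q x.vec) - star x.scal) := by abel
    rw [this, h, sub_self]
  exact sub_eq_zero.1 e

theorem T.mul_mem (x y : X.T) :
    X.q (x.vec + y.vec) - (x.scal + y.scal + X.f y.vec x.vec) ∈ X.K₀ := by
  have h1 := X.q_add x.vec y.vec
  have h2 := X.add_star_mem (X.f x.vec y.vec)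
  rw [X.star_f] at h2
  have h3 := X.K₀.add_mem (X.K₀.add_mem (X.K₀.add_mem h1 h2) x.mem) y.mem
  convert h3 using 1
  abel

theorem T.inv_mem (x : X.T) : X.q (-x.vec) - -star x.scal ∈ X.K₀ := by
  have h1 := X.q_add x.vec (-x.vec)
  rw [add_neg_cancel, X.f_neg_right, x.f_self] at h1
  have h2 := X.K₀.sub_mem (X.K₀.sub_mem X.q_zero_mem h1) x.mem
  convert h2 using 1
  abel

/-- `(a, t) · (b, v) = (a + b, t + v + f(b, a))`. -/
instance : Mul X.T := ⟨fun x y => ⟨x.vec + y.vec, x.scal + y.scal + X.f y.vec x.vec, x.mul_mem y⟩⟩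

instance : One X.T := ⟨⟨0, 0, by simpa using X.q_zero_mem⟩⟩

/-- `(a, t)⁻¹ = (-a, -t^σ)`. -/
instance : Inv X.T := ⟨fun x => ⟨-x.vec, -star x.scal, x.inv_mem⟩⟩

instance : Group X.T :=
  Group.ofLeftAxioms
    (fun x y z => T.ext (add_assoc _ _ _) (by
      change x.scal + y.scal + X.f y.vec x.vec + z.scal + X.f z.vec (x.vec + y.vec) =
        x.scal + (y.scal + z.scal + X.f z.vec y.vec) + X.f (y.vec + z.vec) x.vec
      rw [X.f_add_left, X.f_add_right]
      abel))
    (fun x => T.ext (zero_add _) (by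
      change 0 + x.scal + X.f x.vec 0 = x.scal
      rw [X.f_zero_right, zero_add, add_zero]))
    (fun x => T.ext (neg_add_cancel _) (by
      change -star x.scal + x.scal + X.f x.vec (-x.vec) = 0
      rw [X.f_neg_right, x.f_self]
      abel))

/-- The element `(0, t)` of `T`, for `t ∈ K₀`. -/
def T.ofK₀ (t : X.K₀) : X.T := ⟨0, t, X.K₀.sub_mem X.q_zero_mem t.2⟩

theorem T.scal_ne_zero (x : X.T) (h : x.vec ≠ 0) : x.scal ≠ 0 := fun h0 =>
  h ((X.q_mem_iff _).1 (by simpa [h0] using x.mem))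

theorem T.hua_mem (x y : X.T) :
    X.q (op (star x.scal) • y.vec -
        op (x.scal⁻¹ * X.f x.vec y.vec * star x.scal) • x.vec) -
      x.scal * y.scal * star x.scal ∈ X.K₀ := by
  obtain ⟨a, t, hat⟩ := x
  obtain ⟨b, v, hbv⟩ := y
  dsimp only
  by_cases ht : t = 0
  · subst ht
    simpa using X.q_zero_mem
  have hσ : star t ≠ 0 := by simpa using ht
  set s := t⁻¹ * X.f a b * star t with hs
  have h1 := X.q_add (op (star t) • b) (-(op s • a))
  rw [← sub_eq_add_neg] at h1
  have h2 := X.q_smul b (star t)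
  have h3 := X.q_smul a (-s)
  have e : op (-s) • a = -(op s • a) := by simp
  rw [e] at h3
  have h4 := X.conj_mem (star t) _ hbv
  have h5 := X.conj_mem s _ hat
  have h6 := X.conj_mem (X.f a b * star t) _ (X.add_star_mem t⁻¹)
  rw [X.f_neg_right, X.f_smul_smul] at h1
  have h7 := X.K₀.add_mem (X.K₀.add_mem (X.K₀.add_mem (X.K₀.add_mem (X.K₀.add_mem h1 h2) h3) h4)
    h5) h6
  convert h7 using 1
  have e1 : star (star t) * X.f b a * s =
      -(star (X.f a b * star t) * t⁻¹ * (X.f a b * star t)) := by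
    rw [star_mul, X.star_f, hs]
    noncomm_ring
  have e2 : star s * t * s =
      star (X.f a b * star t) * star t⁻¹ * (X.f a b * star t) := by
    rw [hs, mul_assoc t⁻¹, star_mul _ (_ * _)]
    simp only [mul_assoc, mul_inv_cancel_left₀ ht]
  rw [e1, mul_sub (star s), sub_mul _ _ s, e2, star_neg, star_star]
  noncomm_ring

/-- The Hua map `h_{(a,t)} : (b, v) ↦ (b t^σ - a t⁻¹ f(a, b) t^σ, t v t^σ)`
(for `(a, t) = (0, 0)` it is constantly `(0, 0)`). -/
def T.hua (x y : X.T) : X.T :=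
  ⟨op (star x.scal) • y.vec - op (x.scal⁻¹ * X.f x.vec y.vec * star x.scal) • x.vec,
    x.scal * y.scal * star x.scal, x.hua_mem y⟩

variable {K' L' : Type*} [DivisionRing K'] [StarRing K'] [AddCommGroup L'] [Module K'ᵐᵒᵖ L']
  {X' : PseudoQuadraticSpace K' L'}

/-- A Jordan isomorphism: an isomorphism of groups `T → T'` that maps `(0, 1)` to `(0, 1)` and,
written `γ(a, t) = (φ₁(a), φ₂(a, t))`, satisfies
`φ₁(b t^σ - a t⁻¹ f(a, b) t^σ) = φ₁(b) φ₂(a, t)^σ - φ₁(a) φ₂(a, t)⁻¹ f(φ₁(a), φ₁(b)) φ₂(a, t)^σ`,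
`φ₂(b t^σ - a t⁻¹ f(a, b) t^σ, t v t^σ) = φ₂(a, t) φ₂(b, v) φ₂(a, t)^σ`
for all `(a, t), (b, v) ∈ T`; these are the two components of `map_hua`. -/
structure IsJordanIso (γ : X.T ≃* X'.T) : Prop where
  map_unit : γ (T.ofK₀ ⟨1, X.one_mem⟩) = T.ofK₀ ⟨1, X'.one_mem⟩
  map_hua : ∀ x y : X.T, γ (x.hua y) = (γ x).hua (γ y)

/-- An isomorphism `(φ, ϕ) : (L, K) → (L', K')` of pseudo-quadratic spaces. -/
structure Iso (X : PseudoQuadraticSpace K L) (X' : PseudoQuadraticSpace K' L') where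
  vec : L ≃+ L'
  scal : K ≃+* K'
  map_smul : ∀ (a : L) (t : K), vec (op t • a) = op (scal t) • vec a
  map_star : ∀ t, scal (star t) = star (scal t)
  map_K₀ : scal '' (X.K₀ : Set K) = (X'.K₀ : Set K')
  map_q : ∀ a, scal (X.q a) - X'.q (vec a) ∈ X'.K₀

/-- `γ` is induced by `Φ = (φ, ϕ)`: `γ(a, t) = (φ(a), ϕ(t))` for all `(a, t) ∈ T`. -/
def Iso.Induces (Φ : Iso X X') (γ : X.T ≃* X'.T) : Prop :=
  ∀ x : X.T, (γ x).vec = Φ.vec x.vec ∧ (γ x).scal = Φ.scal x.scal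

end PseudoQuadraticSpace

/-!
The center of `T` is `{0} × K₀`, so a Jordan isomorphism `γ` induces isomorphisms `φ : L ≃ L'` and
`K₀ ≃ K₀'`, and the Hua maps of the elements of `K₀` show that `φ` turns right multiplications by
elements of `K₀` into right multiplications by elements of `K₀'`. If `K₀` generates `K`, then `φ`
transports all right multiplications, which yields `ϕ : K ≃ K'`.

Otherwise `K₀` is central by the Cartan–Brauer–Hua theorem, so every `t ∈ K` is a root of the
quadratic polynomial `X² - (t + t^σ) X + t t^σ` over `K₀`. Polarizing the Hua identity over `K₀`
shows that `φ(a t) = φ(a) s` whenever `γ(a, t) = (φ(a), s)`. For `t ≠ t^σ`, the skew-field `K` is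
the sum of `K₀ + K₀ t`, the centralizer of `t`, and of the space of all `j` with `j t^σ = t j`. This
decomposition gives `φ(b t) = φ(b) s` for all `b`, unless there is a nonzero vector `c ⊥ a` with
`φ(c) = φ(a) j'` and `j' s^σ = s j'`, or such a vector for `γ⁻¹`. The existence of `j'` forces `K'`
to be noncommutative. A vector orthogonal to `a` and `c` vanishes, so that `dim L = 2`, and an
isomorphism `ψ : K ≃ K'` compatible with `γ` on the centers provides `i ∈ K` with `i t^σ = t i` and
`ψ(i²) = j'²`. Then `q(a i + c) ∈ K₀` although `a i + c ≠ 0`, a contradiction.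
-/

theorem exists_add_star_ne_zero {R : Type*} [Ring R] [StarRing R] (hσ : ∃ x : R, star x ≠ x) :
    ∃ x : R, x + star x ≠ 0 := by
  by_contra! hc
  obtain ⟨x, hx⟩ := hσ
  have h2 : (1 + 1 : R) = 0 := by simpa using hc 1
  have hxx : x + x = 0 := by rw [← mul_one x, ← mul_add, h2, mul_zero]
  exact hx (add_left_cancel ((hc x).trans hxx.symm))

theorem map_star_of_closure_eq_top {R R' : Type*} [Ring R] [StarRing R] [Ring R'] [StarRing R']
    (ϕ : R →+* R') {s : Set R} (hs : Subring.closure s = ⊤)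
    (h : ∀ x ∈ s, ϕ (star x) = star (ϕ x)) (x : R) : ϕ (star x) = star (ϕ x) := by
  induction hs ▸ Subring.mem_top x using Subring.closure_induction with
  | mem x hx => exact h x hx
  | zero => simp
  | one => simp
  | add x y _ _ hx hy => simp [hx, hy]
  | neg x _ hx => simp [hx]
  | mul x y _ _ hx hy => simp [hx, hy]

theorem commute_of_conj_mem_of_notMem {K : Type*} [DivisionRing K] {D : Subfield K}
    (hD : ∀ a : K, ∀ x ∈ D, a * x * a⁻¹ ∈ D) {r x : K} (hr : r ∈ D) (hx : x ∉ D) :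
    Commute r x := by
  have hx0 : x ≠ 0 := fun h0 => hx (h0 ▸ zero_mem D)
  have hx1 : x + 1 ≠ 0 := fun h0 => hx (eq_neg_of_add_eq_zero_left h0 ▸ neg_mem D.one_mem)
  have hr₁ := hD x r hr
  have hr₂ := hD (x + 1) r hr
  set r₁ := x * r * x⁻¹
  set r₂ := (x + 1) * r * (x + 1)⁻¹
  have hr₁x : r₁ * x = x * r := inv_mul_cancel_right₀ hx0 _
  have hr₂x : r₂ * (x + 1) = (x + 1) * r := inv_mul_cancel_right₀ hx1 _
  have hdiff : (r₂ - r₁) * x = r - r₂ := by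
    linear_combination (norm := noncomm_ring) hr₂x - hr₁x
  by_cases heq : r₂ - r₁ = 0
  · rw [heq, zero_mul, eq_comm, sub_eq_zero] at hdiff
    rw [← sub_eq_zero.1 heq, ← hdiff] at hr₁x
    exact hr₁x
  · refine absurd ?_ hx
    rw [← inv_mul_cancel_left₀ heq x, hdiff]
    exact mul_mem (inv_mem (sub_mem hr₂ hr₁)) (sub_mem hr hr₂)

theorem cartan_brauer_hua {K : Type*} [DivisionRing K] {D : Subfield K}
    (hD : ∀ a : K, ∀ x ∈ D, a * x * a⁻¹ ∈ D) (hne : D ≠ ⊤) {r : K} (hr : r ∈ D) (x : K) :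
    Commute r x := by
  obtain ⟨z, hz⟩ : ∃ z, z ∉ D := by
    by_contra! hc
    exact hne (eq_top_iff.2 fun x _ => hc x)
  by_cases hx : x ∈ D
  · have hxz : x + z ∉ D := fun hc => hz (by simpa using sub_mem hc hx)
    simpa using (commute_of_conj_mem_of_notMem hD hr hxz).sub_right
      (commute_of_conj_mem_of_notMem hD hr hz)
  · exact commute_of_conj_mem_of_notMem hD hr hx

theorem exists_semiconjBy_of_quadratic {R : Type*} [Ring R] {t τ T N : R}
    (hT : ∀ x, T * x = x * T) (hN : ∀ x, N * x = x * N) (ht : t * (T - t) = N)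
    (hτ : (T - τ) * τ = N) (hne : ∃ y, t * y ≠ y * (T - τ)) : ∃ g ≠ 0, SemiconjBy g τ t := by
  obtain ⟨y, hy⟩ := hne
  refine ⟨t * y - y * (T - τ), sub_ne_zero.2 hy, ?_⟩
  rw [SemiconjBy]
  linear_combination (norm := noncomm_ring) -y * hτ + ht * y - t * hT y + hN y

theorem eq_zero_of_semiconjBy_star {R : Type*} [Ring R] [IsDomain R] [Star R]
    (hR : ∀ x y : R, x * y = y * x) {t j : R} (ht : star t ≠ t) (hj : SemiconjBy j (star t) t) :
    j = 0 := by
  have h : j * (star t - t) = 0 := by rw [mul_sub, hj.eq, hR t, sub_self]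
  exact (mul_eq_zero.1 h).resolve_right (sub_ne_zero.2 ht)

section Intertwiners

open scoped RightActions

variable {K K' F L L' : Type*} [Ring K] [AddCommGroup L] [Module Kᵐᵒᵖ L]
  [Ring K'] [AddCommGroup L'] [Module K'ᵐᵒᵖ L'] [FunLike F L L'] [AddMonoidHomClass F L L']

/-- The pairs of scalars `(x, y)` such that `φ` turns the right multiplication by `x` into the right
multiplication by `y`. -/
def intertwiners (K K' : Type*) {F L L' : Type*} [Ring K] [AddCommGroup L] [Module Kᵐᵒᵖ L] [Ring K']
    [AddCommGroup L'] [Module K'ᵐᵒᵖ L'] [FunLike F L L'] [AddMonoidHomClass F L L'] (φ : F) :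
    Subring (K × K') where
  carrier := {p | ∀ a : L, φ (a <• p.1) = φ a <• p.2}
  mul_mem' {p r} hp hr a := by
    rw [Prod.fst_mul, Prod.snd_mul, op_smul_mul, op_smul_mul, hr, hp]
  one_mem' a := by simp
  add_mem' {p r} hp hr a := by
    rw [Prod.fst_add, Prod.snd_add, op_add, op_add, add_smul, add_smul, map_add, hp, hr]
  zero_mem' a := by simp
  neg_mem' {p} hp a := by
    rw [Prod.fst_neg, Prod.snd_neg, op_neg, op_neg, neg_smul, neg_smul, map_neg, hp]

theorem exists_ringHom_of_map_fst_intertwiners_eq_top [FaithfulSMul K'ᵐᵒᵖ L'] (φ : L ≃+ L')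
    (h : (intertwiners K K' φ).map (RingHom.fst K K') = ⊤) :
    ∃ ϕ : K →+* K', ∀ a x, φ (a <• x) = φ a <• ϕ x := by
  let e : intertwiners K K' φ →+* K := (RingHom.fst K K').comp (Subring.subtype _)
  have hinj : Function.Injective e := fun ⟨p, hp⟩ ⟨r, hr⟩ hpr =>
    Subtype.ext <| Prod.ext hpr <| op_injective <| eq_of_smul_eq_smul <| φ.surjective.forall.2
      fun a => (hp a).symm.trans <| (congrArg (fun x => φ (a <• x)) hpr).trans (hr a)
  have hsurj : Function.Surjective e := fun x => by
    obtain ⟨p, hp, hpx⟩ : x ∈ (intertwiners K K' φ).map (RingHom.fst K K') := h ▸ Subring.mem_top x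
    exact ⟨⟨p, hp⟩, hpx⟩
  let e' := RingEquiv.ofBijective e ⟨hinj, hsurj⟩
  refine ⟨((RingHom.snd K K').comp (Subring.subtype _)).comp e'.symm.toRingHom, fun a x => ?_⟩
  have hx : (e'.symm x).1.1 = x := e'.apply_symm_apply x
  exact (congrArg (fun y => φ (a <• y)) hx.symm).trans ((e'.symm x).2 a)

end Intertwiners

section Quadratic

open scoped RightActions

theorem eq_zero_of_quadratic_eq_zero {R M : Type*} [DivisionRing R] [AddCommGroup M] [Module Rᵐᵒᵖ M]
    {A B C : M} {m : R} (hm0 : m ≠ 0) (hm1 : m ≠ 1) (h0 : A = 0) (h1 : A + B + C = 0)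
    (hm : A + B <• m + C <• (m * m) = 0) : C = 0 := by
  have hB : B = -C := eq_neg_of_add_eq_zero_left (by simpa [h0] using h1)
  have hC : C <• (m * (m - 1)) = 0 := by
    rw [mul_sub_one, op_sub, sub_smul]
    simpa [h0, hB, neg_add_eq_sub] using hm
  refine (smul_eq_zero.1 hC).resolve_left ?_
  rw [op_eq_zero_iff]
  exact mul_ne_zero hm0 (sub_ne_zero.2 hm1)

theorem add_mul_mul_add_of_forall_commute {R : Type*} [Ring R] {k : R} (hk : ∀ x, k * x = x * k)
    (u w : R) : (u + k) * w * (u + k) = u * w * u + (u * w + w * u) * k + w * (k * k) := by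
  linear_combination (norm := noncomm_ring) hk (w * u) + hk (w * k)

theorem mul_sub_mul_self_of_commute {R : Type*} [Ring R] {t u : R} (h : Commute t u) :
    u * (t - u) * u = u * (t * u + t * u - (t + u) * (t + u)) + (t + u) * (t * u) := by
  linear_combination (norm := noncomm_ring) -h.eq * t - t * h.eq - u * h.eq

theorem map_smul_mul_sub_mul_self_sub {K K' F L L' : Type*} [Ring K] [AddCommGroup L]
    [Module Kᵐᵒᵖ L] [Ring K'] [AddCommGroup L'] [Module K'ᵐᵒᵖ L'] [FunLike F L L']
    [AddMonoidHomClass F L L'] {φ : F} {t u : K} {s v : K'} (htu : Commute t u) (hsv : Commute s v)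
    (hadd : (t + u, s + v) ∈ intertwiners K K' φ) (hmul : (t * u, s * v) ∈ intertwiners K K' φ)
    (a : L) : φ (a <• (u * (t - u) * u)) - φ a <• (v * (s - v) * v) =
      (φ (a <• u) - φ a <• v) <• (s * v + s * v - (s + v) * (s + v)) := by
  have hquad : φ (a <• u <• (t * u + t * u - (t + u) * (t + u))) =
      φ (a <• u) <• (s * v + s * v - (s + v) * (s + v)) :=
    sub_mem (add_mem hmul hmul) (mul_mem hadd hadd) (a <• u)
  have hcubic : φ (a <• ((t + u) * (t * u))) = φ a <• ((s + v) * (s * v)) := mul_mem hadd hmul a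
  rw [mul_sub_mul_self_of_commute htu, mul_sub_mul_self_of_commute hsv, op_add, op_add, add_smul,
    add_smul, map_add, op_smul_mul _ u, op_smul_mul _ v, hcubic, hquad, smul_sub]
  abel

end Quadratic

namespace InvolutorySet

variable {K : Type*} [DivisionRing K] [StarRing K] (S : InvolutorySet K)

theorem mul_mul_star_mem (a : K) {t : K} (ht : t ∈ S.K₀) : a * t * star a ∈ S.K₀ := by
  simpa using S.conj_mem (star a) t ht

/-- The norm `a a^σ` as an element of `K₀`. -/
def norm (a : K) : S.K₀ := ⟨a * star a, by simpa using S.mul_mul_star_mem a S.one_mem⟩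

/-- The trace `a + a^σ` as an element of `K₀`. -/
def trace (a : K) : S.K₀ := ⟨a + star a, S.add_star_mem a⟩

@[simp]
theorem coe_norm (a : K) : (S.norm a : K) = a * star a := rfl

@[simp]
theorem coe_trace (a : K) : (S.trace a : K) = a + star a := rfl

theorem norm_add_one (a : K) : S.norm (a + 1) = S.norm a + S.trace a + ⟨1, S.one_mem⟩ :=
  Subtype.ext (by simp [mul_add, add_mul]; abel)

theorem inv_mem {k : K} (hk : k ∈ S.K₀) : k⁻¹ ∈ S.K₀ := by
  rcases eq_or_ne k 0 with rfl | h0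
  · simp
  · simpa [S.star_eq k hk, h0] using S.mul_mul_star_mem k⁻¹ hk

theorem star_mem_closure {x : K} (hx : x ∈ Subring.closure (S.K₀ : Set K)) :
    star x ∈ Subring.closure (S.K₀ : Set K) := by
  induction hx using Subring.closure_induction with
  | mem x hx => exact Subring.subset_closure ((S.star_eq x hx).symm ▸ hx)
  | zero => simp
  | one => simp
  | add x y _ _ hx hy => rw [star_add]; exact add_mem hx hy
  | neg x _ hx => rw [star_neg]; exact neg_mem hx
  | mul x y _ _ hx hy => rw [star_mul]; exact mul_mem hy hx

theorem inv_mem_closure {x : K} (hx : x ∈ Subring.closure (S.K₀ : Set K)) :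
    x⁻¹ ∈ Subring.closure (S.K₀ : Set K) := by
  rcases eq_or_ne x 0 with rfl | h0
  · simp
  rw [← mul_inv_cancel_left₀ (star_ne_zero.2 h0) x⁻¹, ← mul_inv_rev]
  exact mul_mem (S.star_mem_closure hx) (Subring.subset_closure (S.inv_mem (S.norm x).2))

theorem conj_mem_closure (a : K) {x : K} (hx : x ∈ Subring.closure (S.K₀ : Set K)) :
    a * x * a⁻¹ ∈ Subring.closure (S.K₀ : Set K) := by
  rcases eq_or_ne a 0 with rfl | ha
  · simp
  induction hx using Subring.closure_induction with
  | mem x hx =>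
    have h : a * x * a⁻¹ = a * x * star a * (S.norm (star a)⁻¹) := by
      simp [mul_assoc, ha]
    rw [h]
    exact mul_mem (Subring.subset_closure (S.mul_mul_star_mem a hx))
      (Subring.subset_closure (S.norm _).2)
  | zero => simp
  | one => simp [ha]
  | add x y _ _ hx hy => rw [mul_add, add_mul]; exact add_mem hx hy
  | neg x _ hx => rw [mul_neg, neg_mul]; exact neg_mem hx
  | mul x y _ _ hx hy => simpa [mul_assoc, ha] using mul_mem hx hy

/-- `K₀` lies in the center of `K`. -/
def IsCentral : Prop := ∀ k ∈ S.K₀, ∀ x : K, k * x = x * k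

theorem isCentral_of_closure_ne_top (h : Subring.closure (S.K₀ : Set K) ≠ ⊤) : S.IsCentral := by
  let D : Subfield K :=
    { Subring.closure (S.K₀ : Set K) with inv_mem' := fun _ => S.inv_mem_closure }
  have hD : D ≠ ⊤ := fun hc => h (eq_top_iff.2 fun x _ => (hc ▸ Subfield.mem_top x : x ∈ D))
  exact fun k hk x =>
    cartan_brauer_hua (D := D) (fun a _ => S.conj_mem_closure a) hD (Subring.subset_closure hk) x

variable {S}

theorem IsProperInvolutorySet.exists_not_commute (hS : S.IsProperInvolutorySet) :
    ∃ k ∈ S.K₀, ∃ l ∈ S.K₀, ¬ Commute k l := by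
  by_contra! hc
  obtain ⟨⟨x, hx⟩, hgen⟩ := hS
  have hgen' (y : K) : y ∈ Subring.closure (S.K₀ : Set K) := hgen ▸ Subring.mem_top y
  have := Subring.isMulCommutative_closure hc
  have hcomm (y z : K) : y * z = z * y :=
    congrArg Subtype.val (this.is_comm.comm ⟨y, hgen' y⟩ ⟨z, hgen' z⟩)
  let σ : K →+* K := { starAddEquiv (R := K) with
    map_one' := star_one K
    map_zero' := star_zero K
    map_mul' := fun y z => (star_mul y z).trans (hcomm _ _) }
  have hσ : Set.EqOn σ (RingHom.id K) (Subring.closure (S.K₀ : Set K)) :=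
    RingHom.eqOn_set_closure S.star_eq
  exact hx (hσ (hgen' x))

namespace IsCentral

theorem star_mul_self (hZ : S.IsCentral) (x : K) : star x * x = x * star x := by
  rcases eq_or_ne x 0 with rfl | h0
  · simp
  · exact mul_left_cancel₀ h0 (by simpa [mul_assoc] using hZ _ (S.norm x).2 x)

theorem mul_mem (hZ : S.IsCentral) (hσ : ∃ x : K, star x ≠ x) {k l : K} (hk : k ∈ S.K₀)
    (hl : l ∈ S.K₀) : k * l ∈ S.K₀ := by
  obtain ⟨x, hx⟩ := exists_add_star_ne_zero hσ
  set m := x + star x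
  have hm : m⁻¹ ∈ S.K₀ := S.inv_mem (S.trace x).2
  have h : (S.trace (k * (l * (m⁻¹ * x))) : K) = k * l := by
    rw [coe_trace, star_mul, star_mul, star_mul, S.star_eq k hk, S.star_eq l hl, S.star_eq _ hm,
      ← hZ _ hm, ← hZ l hl, ← hZ k hk, ← mul_add, ← mul_add, ← mul_add, inv_mul_cancel₀ hx, mul_one]
  exact h ▸ (S.trace _).2

theorem commute_star (hZ : S.IsCentral) {t w : K} (h : Commute w t) : Commute w (star t) := by
  have hT : Commute w (t + star t) := (hZ _ (S.trace t).2 w).symm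
  simpa using hT.sub_right h

theorem semiconjBy_symm (hZ : S.IsCentral) {t j : K} (h : SemiconjBy j (star t) t) :
    SemiconjBy j t (star t) := by
  have hT : SemiconjBy j (t + star t) (t + star t) := (hZ _ (S.trace t).2 j).symm
  simpa using hT.sub_right h

theorem star_eq_neg_of_semiconjBy (hZ : S.IsCentral) {t j : K} (ht : star t ≠ t)
    (h : SemiconjBy j (star t) t) : star j = -j := by
  have hj : star j * star t = t * star j := by simpa using (congrArg star h.eq).symm
  have hT := hZ _ (S.trace j).2 t
  rw [coe_trace] at hT
  have h0 : (j + star j) * (t - star t) = 0 := by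
    linear_combination (norm := noncomm_ring) hT - h.eq - hj
  rcases mul_eq_zero.1 h0 with h1 | h1
  · exact eq_neg_of_add_eq_zero_right h1
  · exact absurd (sub_eq_zero.1 h1).symm ht

theorem exists_eq_add_mul_of_commute (hZ : S.IsCentral) {t w : K} (ht : star t ≠ t)
    (hw : Commute w t) : ∃ k l : S.K₀, w = k + l * t := by
  have hd : t - star t ≠ 0 := fun h => ht (sub_eq_zero.1 h).symm
  set n := S.norm (t - star t)
  have hn : (n : K) ≠ 0 := mul_ne_zero hd (star_ne_zero.2 hd)
  have hn' := S.inv_mem n.2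
  have hwt : w * star t = star t * w := hZ.commute_star hw
  have hsw : star w * t = t * star w := (hZ.commute_star hw.symm).symm.eq
  have hss : star w * star t = star t * star w := by
    simpa using (congrArg star hw.eq).symm
  have key : (n : K) * w =
      -(S.trace ((t - star t) * (star w * t)) + S.trace ((t - star t) * w) * t) := by
    simp only [n, coe_norm, coe_trace, star_mul, star_sub, star_star]
    linear_combination (norm := noncomm_ring) star t * hwt - 2 * star t * hw.eq + t * hw.eq +
      hss * t - hsw * t - hZ.star_mul_self t * w
  refine ⟨⟨(n : K)⁻¹ * -S.trace ((t - star t) * (star w * t)),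
      hZ.mul_mem ⟨t, ht⟩ hn' (neg_mem (S.trace _).2)⟩,
    ⟨(n : K)⁻¹ * -S.trace ((t - star t) * w), hZ.mul_mem ⟨t, ht⟩ hn' (neg_mem (S.trace _).2)⟩, ?_⟩
  linear_combination (norm := noncomm_ring) (n : K)⁻¹ * key - inv_mul_cancel_left₀ hn w

theorem exists_commute_add_semiconjBy (hZ : S.IsCentral) {t : K} (ht : star t ≠ t) (x : K) :
    ∃ w j, x = w + j ∧ Commute w t ∧ SemiconjBy j (star t) t := by
  have hd : t - star t ≠ 0 := fun h => ht (sub_eq_zero.1 h).symm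
  have hT := hZ _ (S.trace t).2 x
  have hN := hZ _ (S.norm t).2 x
  have htt := hZ.star_mul_self t
  rw [coe_trace] at hT
  rw [coe_norm] at hN
  have hv : SemiconjBy (t * x - x * t) (star t) t := by
    rw [SemiconjBy]
    linear_combination (norm := noncomm_ring) -t * hT + hN
  have hdt : Commute (t - star t) t := (Commute.refl t).sub_left htt
  have hj : SemiconjBy ((t - star t)⁻¹ * (t * x - x * t)) (star t) t :=
    SemiconjBy.mul_left hdt.inv_left₀ hv
  refine ⟨_, _, (sub_add_cancel x _).symm, ?_, hj⟩
  have hjt := (hZ.semiconjBy_symm hj).eq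
  have hdj := mul_inv_cancel_left₀ hd (t * x - x * t)
  set j := (t - star t)⁻¹ * (t * x - x * t)
  rw [Commute, SemiconjBy]
  linear_combination (norm := noncomm_ring) hdj - hjt

theorem inv_mul_mul_norm (hZ : S.IsCentral) (t u : K) : t⁻¹ * u * (t * star t) = star t * u := by
  rcases eq_or_ne t 0 with rfl | h0
  · simp
  · rw [← S.coe_norm, ← hZ _ (S.norm t).2, S.coe_norm, ← hZ.star_mul_self, mul_assoc,
      mul_inv_cancel_left₀ h0]

theorem semiconjBy_star_iff (hZ : S.IsCentral) {t w : K} (ht : star t ≠ t) :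
    SemiconjBy w (star t) t ↔ S.trace w = 0 ∧ S.trace (star t * w) = 0 := by
  have trace_eq_zero {j : K} (hj : SemiconjBy j (star t) t) : S.trace j = 0 :=
    Subtype.ext (by simp [hZ.star_eq_neg_of_semiconjBy ht hj])
  refine ⟨fun hw => ⟨trace_eq_zero hw, trace_eq_zero (SemiconjBy.mul_left (hZ.star_mul_self t) hw)⟩,
    fun ⟨hw, htw⟩ => ?_⟩
  have hw' : star w = -w := eq_neg_of_add_eq_zero_right (congrArg Subtype.val hw)
  have htw' : star t * w + star w * t = 0 := by simpa using congrArg Subtype.val htw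
  have hT := hZ _ (S.trace t).2 w
  rw [coe_trace] at hT
  rw [hw'] at htw'
  rw [SemiconjBy]
  linear_combination (norm := noncomm_ring) htw' - hT

theorem exists_semiconjBy_mul_self_eq {K : Type*} [DivisionRing K]
    [StarRing K] {S : InvolutorySet K} (hZ : S.IsCentral) {t τ i : K} (ht : star t ≠ t)
    (hτ : (t + star t - τ) * τ = t * star t) (hi0 : i ≠ 0)
    (hi : SemiconjBy i (t + star t - τ) τ) (hii : i * i ∈ S.K₀) :
    ∃ i₀, SemiconjBy i₀ (star t) t ∧ i₀ * i₀ = i * i := by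
  have hT := hZ _ (S.trace t).2
  obtain ⟨g, hg0, hg⟩ : ∃ g ≠ 0, SemiconjBy g τ t := by
    refine exists_semiconjBy_of_quadratic hT (hZ _ (S.norm t).2) (by simp) (by simpa using hτ) ?_
    by_contra! hc
    have hτt : t = t + star t - τ := by simpa using hc 1
    have hti : t * i = τ * i := (hc i).trans hi.eq
    rw [← mul_right_cancel₀ hi0 hti, add_sub_cancel_left] at hτt
    exact ht hτt.symm
  have hg' : SemiconjBy g (t + star t - τ) (star t) := by
    have hgT : SemiconjBy g (t + star t) (t + star t) := (hT g).symm
    simpa using hgT.sub_right hg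
  refine ⟨g * i * g⁻¹, (hg.mul_left hi).mul_left (SemiconjBy.inv_symm_left₀ hg'), ?_⟩
  calc g * i * g⁻¹ * (g * i * g⁻¹) = g * (i * i) * g⁻¹ := by simp [mul_assoc, hg0]
    _ = i * i := by rw [← hZ _ hii, mul_inv_cancel_right₀ hg0]

theorem eq_top_of_forall_star_mul_mul_mem (hZ : S.IsCentral) {P : Subring K}
    (hK₀ : (S.K₀ : Set K) ⊆ P) {t : K} (ht : star t ≠ t) (hP : ∀ c, star c * t * c ∈ P) :
    P = ⊤ := by
  have htP : t ∈ P := by simpa using hP 1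
  have hd : t - star t ≠ 0 := fun h => ht (sub_eq_zero.1 h).symm
  have hdt : Commute (t - star t) t := (Commute.refl t).sub_left (hZ.star_mul_self t)
  have hskew {j : K} (hj : SemiconjBy j (star t) t) : j ∈ P := by
    set i := (t - star t)⁻¹ * j
    have hdi : (t - star t) * i = j := mul_inv_cancel_left₀ hd j
    have hi : SemiconjBy i (star t) t := SemiconjBy.mul_left hdt.inv_left₀ hj
    have hij : j = star (i + 1) * t * (i + 1) - star i * t * i - t := by
      rw [star_add, star_one, hZ.star_eq_neg_of_semiconjBy ht hi]
      linear_combination (norm := noncomm_ring) (hZ.semiconjBy_symm hi).eq - hdi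
    exact hij ▸ sub_mem (sub_mem (hP _) (hP _)) htP
  refine eq_top_iff.2 fun x _ => ?_
  obtain ⟨w, j, rfl, hw, hj⟩ := hZ.exists_commute_add_semiconjBy ht x
  obtain ⟨k, l, rfl⟩ := hZ.exists_eq_add_mul_of_commute ht hw
  exact add_mem (add_mem (hK₀ k.2) (Subring.mul_mem P (hK₀ l.2) htP)) (hskew hj)

theorem mul_comm_of_forall_semiconjBy_eq_zero (hZ : S.IsCentral) {t : K} (ht : star t ≠ t)
    (h : ∀ j, SemiconjBy j (star t) t → j = 0) (x y : K) : x * y = y * x := by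
  have hlin (x : K) : ∃ k l : S.K₀, x = k + l * t := by
    obtain ⟨w, j, rfl, hw, hj⟩ := hZ.exists_commute_add_semiconjBy ht x
    rw [h j hj, add_zero]
    exact hZ.exists_eq_add_mul_of_commute ht hw
  obtain ⟨k, l, rfl⟩ := hlin x
  obtain ⟨m, n, rfl⟩ := hlin y
  have hmn : (m + n * t) * t = t * (m + n * t) := by
    linear_combination (norm := noncomm_ring) hZ m m.2 t + hZ n n.2 t * t
  linear_combination (norm := noncomm_ring)
    hZ k k.2 (m + n * t) - l * hmn + hZ l l.2 (m + n * t) * t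

end IsCentral

variable (S) in
/-- `K₀ = {0, 1}`, which leaves no room for polarization over `K₀`. -/
def IsMinimal : Prop := ∀ k ∈ S.K₀, k = 0 ∨ k = 1

namespace IsMinimal

theorem charP_two (hS : S.IsMinimal) : CharP K 2 :=
  CharTwo.of_one_ne_zero_of_two_eq_zero one_ne_zero <| by
    rw [← one_add_one_eq_two]
    exact (hS _ (add_mem S.one_mem S.one_mem)).resolve_right fun h => one_ne_zero (add_eq_left.1 h)

theorem mem_of_star_eq (hS : S.IsMinimal) {x : K} (hx : star x = x) : x ∈ S.K₀ := by
  have := hS.charP_two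
  have hxx : x * x ∈ S.K₀ := by simpa [hx] using (S.norm x).2
  rcases hS _ hxx with h0 | h1
  · exact mul_self_eq_zero.1 h0 ▸ zero_mem _
  · rcases mul_self_eq_one_iff.1 h1 with rfl | rfl
    exacts [S.one_mem, neg_mem S.one_mem]

theorem add_star_eq_one (hS : S.IsMinimal) {x : K} (hx : star x ≠ x) :
    x + star x = 1 := by
  have := hS.charP_two
  refine (hS _ (S.add_star_mem x)).resolve_left fun h0 => hx ?_
  rw [eq_neg_of_add_eq_zero_right h0, CharTwo.neg_eq]

theorem card_eq_four (hS : S.IsMinimal) {t : K} (ht : star t ≠ t) :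
    Nat.card K = 4 := by
  have := hS.charP_two
  have hZ : S.IsCentral := fun k hk x => by rcases hS k hk with rfl | rfl <;> simp
  have hskew {j : K} (hj : SemiconjBy j (star t) t) : j = 0 := by
    have hstar : star j = j := by rw [hZ.star_eq_neg_of_semiconjBy ht hj, CharTwo.neg_eq]
    rcases hS j (hS.mem_of_star_eq hstar) with h0 | rfl
    exacts [h0, absurd (by simpa [SemiconjBy] using hj) ht]
  have hbij : Function.Bijective fun p : S.K₀ × S.K₀ => (p.1 : K) + p.2 * t := by
    constructor
    · rintro ⟨k, l⟩ ⟨m, n⟩ (hkl : (k : K) + l * t = m + n * t)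
      have hln : (l - n : K) * t = m - k := by linear_combination (norm := noncomm_ring) hkl
      rcases hS _ (sub_mem l.2 n.2) with h0 | h1
      · rw [h0, zero_mul, eq_comm, sub_eq_zero] at hln
        exact Prod.ext (Subtype.ext hln.symm) (Subtype.ext (sub_eq_zero.1 h0))
      · rw [h1, one_mul] at hln
        exact absurd (S.star_eq t (hln ▸ sub_mem m.2 k.2)) ht
    · intro x
      obtain ⟨w, j, rfl, hw, hj⟩ := hZ.exists_commute_add_semiconjBy ht x
      obtain ⟨k, l, rfl⟩ := hZ.exists_eq_add_mul_of_commute ht hw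
      exact ⟨(k, l), by rw [hskew hj, add_zero]⟩
  have hK₀ : Nat.card S.K₀ = 2 := Nat.card_eq_two_iff.2
    ⟨0, ⟨1, S.one_mem⟩, fun h01 => zero_ne_one (congrArg Subtype.val h01),
      Set.eq_univ_of_forall fun k => (hS k k.2).imp Subtype.ext Subtype.ext⟩
  rw [← Nat.card_eq_of_bijective _ hbij, Nat.card_prod, hK₀]

theorem nonempty_ringEquiv_galoisField (hS : S.IsMinimal) {t : K}
    (ht : star t ≠ t) : Nonempty (K ≃+* GaloisField 2 2) := by
  have hcard := hS.card_eq_four ht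
  have : Finite K := Nat.finite_of_card_ne_zero (by rw [hcard]; norm_num)
  have := hS.charP_two
  let _ : Field K := littleWedderburn K
  let _ : Algebra (ZMod 2) K := ZMod.algebra K 2
  exact ⟨(GaloisField.algEquivGaloisField 2 2 hcard).toRingEquiv⟩

end IsMinimal

end InvolutorySet

namespace PseudoQuadraticSpace

open scoped RightActions

variable {K L K' L' : Type*}
  [DivisionRing K] [StarRing K] [AddCommGroup L] [Module Kᵐᵒᵖ L]
  [DivisionRing K'] [StarRing K'] [AddCommGroup L'] [Module K'ᵐᵒᵖ L']
  {X : PseudoQuadraticSpace K L} {X' : PseudoQuadraticSpace K' L'}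

@[simp]
theorem T.vec_mul (x y : X.T) : (x * y).vec = x.vec + y.vec := rfl

@[simp]
theorem T.scal_mul (x y : X.T) : (x * y).scal = x.scal + y.scal + X.f y.vec x.vec := rfl

@[simp]
theorem T.vec_ofK₀ (k : X.K₀) : (T.ofK₀ k : X.T).vec = 0 := rfl

@[simp]
theorem T.scal_ofK₀ (k : X.K₀) : (T.ofK₀ k : X.T).scal = k := rfl

theorem T.scal_mul_ofK₀ (x : X.T) (k : X.K₀) : (x * T.ofK₀ k).scal = x.scal + k := by
  simp [X.f_zero_left]

theorem T.scal_sub_scal_mem {x y : X.T} (h : x.vec = y.vec) : x.scal - y.scal ∈ X.K₀ := by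
  simpa [h] using sub_mem y.mem x.mem

theorem T.scal_mem_of_vec_eq_zero {x : X.T} (h : x.vec = 0) : x.scal ∈ X.K₀ := by
  simpa using T.scal_sub_scal_mem (y := T.ofK₀ 0) h

theorem T.vec_eq_zero_of_scal_mem {x : X.T} (h : x.scal ∈ X.K₀) : x.vec = 0 :=
  (X.q_mem_iff _).1 (by simpa using add_mem x.mem h)

theorem T.exists_eq_mul_ofK₀ {x y : X.T} (h : x.vec = y.vec) : ∃ k : X.K₀, x = y * T.ofK₀ k :=
  ⟨⟨_, T.scal_sub_scal_mem h⟩, T.ext (by simpa using h) (by rw [T.scal_mul_ofK₀]; simp)⟩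

/-- The element `(a, q(a))` of `T`. -/
def T.ofVec (X : PseudoQuadraticSpace K L) (a : L) : X.T := ⟨a, X.q a, by simp⟩

@[simp]
theorem T.vec_ofVec (a : L) : (T.ofVec X a).vec = a := rfl

theorem f_surjective (hX : X.IsProper) {a : L} (ha : a ≠ 0) : Function.Surjective (X.f a) := by
  intro u
  obtain ⟨b, hb⟩ : ∃ b, X.f a b ≠ 0 := by
    by_contra! hc
    exact ha (hX.nondegenerate a hc)
  exact ⟨b <• ((X.f a b)⁻¹ * u), by rw [X.f_smul_right, mul_inv_cancel_left₀ hb]⟩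

theorem mem_center_iff (hX : X.IsProper) {x : X.T} :
    x ∈ Subgroup.center X.T ↔ x.vec = 0 := by
  rw [Subgroup.mem_center_iff]
  refine ⟨fun h => ?_, fun h g => T.ext ?_ ?_⟩
  · by_contra ha
    obtain ⟨u, hu⟩ := exists_add_star_ne_zero hX.star_ne
    obtain ⟨b, rfl⟩ := f_surjective hX ha u
    have hb : X.q b + x.scal + X.f x.vec b = x.scal + X.q b + X.f b x.vec :=
      congrArg T.scal (h (T.ofVec X b))
    rw [add_comm (X.q b), add_right_inj] at hb
    rw [X.star_f, hb, add_neg_cancel] at hu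
    exact hu rfl
  · simp [add_comm]
  · simp [h, X.f_zero_left, X.f_zero_right, add_comm]

/-- The element `(a c, c^σ t c)` of `T`, for `(a, t) ∈ T` and `c ∈ K`. -/
def T.smul (x : X.T) (c : K) : X.T where
  vec := x.vec <• c
  scal := star c * x.scal * c
  mem := by simpa [mul_sub, sub_mul] using add_mem (X.q_smul x.vec c) (X.conj_mem c _ x.mem)

@[simp]
theorem T.vec_smul (x : X.T) (c : K) : (x.smul c).vec = x.vec <• c := rfl

@[simp]
theorem T.scal_smul (x : X.T) (c : K) : (x.smul c).scal = star c * x.scal * c := rfl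

@[simp]
theorem T.scal_ofVec (a : L) : (T.ofVec X a).scal = X.q a := rfl

theorem T.f_self_ne_zero {x : X.T} (hx : star x.scal ≠ x.scal) : X.f x.vec x.vec ≠ 0 := by
  rw [x.f_self]
  exact sub_ne_zero.2 hx.symm

theorem T.vec_ne_zero {x : X.T} (hx : star x.scal ≠ x.scal) : x.vec ≠ 0 :=
  fun h0 => hx (X.star_eq _ (T.scal_mem_of_vec_eq_zero h0))

theorem semiconjBy_f_smul (hZ : X.toInvolutorySet.IsCentral) (x : X.T) {j : K}
    (hj : SemiconjBy j (star x.scal) x.scal) :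
    SemiconjBy (X.f x.vec (x.vec <• j)) (star x.scal) x.scal := by
  rw [X.f_smul_right, x.f_self]
  exact SemiconjBy.mul_left ((Commute.refl x.scal).sub_left (hZ.star_mul_self x.scal)) hj

theorem exists_star_scal_ne (hX : X.IsProper) : ∃ x : X.T, star x.scal ≠ x.scal := by
  by_contra! hc
  have hf (a : L) : X.f a a = 0 := by
    rw [← T.vec_ofVec (X := X) a, T.f_self, hc, sub_self]
  obtain ⟨y, hy⟩ := hX.star_ne
  obtain ⟨a, ha⟩ := @exists_ne L hX.nontrivial 0
  obtain ⟨b, rfl⟩ := f_surjective hX ha y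
  have hab := hf (a + b)
  rw [X.f_add_left, X.f_add_right, X.f_add_right, hf, hf, zero_add, add_zero] at hab
  exact hy ((X.star_f a b).trans (neg_eq_of_add_eq_zero_left hab))

section Rank

variable {a c : L}

theorem f_sub_smul_inv_mul_f (ha : X.f a a ≠ 0) (b : L) :
    X.f a (b - a <• ((X.f a a)⁻¹ * X.f a b)) = 0 := by
  rw [sub_eq_add_neg, X.f_add_right, X.f_neg_right, X.f_smul_right, mul_inv_cancel_left₀ ha,
    add_neg_cancel]

theorem one_lt_rank_of_f_eq_zero (ha : X.f a a ≠ 0) (hc : c ≠ 0) (hac : X.f a c = 0) :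
    1 < Module.rank Kᵐᵒᵖ L := by
  by_contra! hr
  obtain ⟨v, hv⟩ := rank_le_one_iff.1 hr
  obtain ⟨r, rfl⟩ := hv a
  obtain ⟨r', rfl⟩ := hv c
  have hr0 : r ≠ 0 := by
    rintro rfl
    simp [X.f_zero_left] at ha
  have hr' : r' • v = (r • v) <• unop (r' * r⁻¹) := by
    rw [op_unop, smul_smul, inv_mul_cancel_right₀ hr0]
  rw [hr', X.f_smul_right] at hac
  exact hc (by rw [hr', (mul_eq_zero.1 hac).resolve_left ha, op_zero, zero_smul])

theorem rank_le_one_of_forall_f_eq_zero (ha : X.f a a ≠ 0) (h : ∀ d, X.f a d = 0 → d = 0) :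
    Module.rank Kᵐᵒᵖ L ≤ 1 :=
  rank_le_one_iff.2 ⟨a, fun b => ⟨_, (sub_eq_zero.1 (h _ (f_sub_smul_inv_mul_f ha b))).symm⟩⟩

theorem rank_le_two_of_forall_f_eq_zero (ha : X.f a a ≠ 0) (hc : X.f c c ≠ 0) (hac : X.f a c = 0)
    (h : ∀ d, X.f a d = 0 → X.f c d = 0 → d = 0) : Module.rank Kᵐᵒᵖ L ≤ 2 := by
  classical
  have htop : Submodule.span Kᵐᵒᵖ (({a, c} : Finset L) : Set L) = ⊤ := eq_top_iff.2 fun b _ => by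
    have hca : X.f c a = 0 := by rw [← neg_eq_zero, ← X.star_f, hac, star_zero]
    have hb := h (b - a <• ((X.f a a)⁻¹ * X.f a b) - c <• ((X.f c c)⁻¹ * X.f c b)) (by
      rw [sub_eq_add_neg, X.f_add_right, f_sub_smul_inv_mul_f ha, X.f_neg_right, X.f_smul_right,
        hac, zero_mul, neg_zero, add_zero]) (by
      rw [sub_right_comm, sub_eq_add_neg, X.f_add_right, f_sub_smul_inv_mul_f hc, X.f_neg_right,
        X.f_smul_right, hca, zero_mul, neg_zero, add_zero])
    rw [sub_eq_zero, sub_eq_iff_eq_add] at hb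
    rw [hb]
    exact add_mem (Submodule.smul_mem _ _ (Submodule.subset_span (by simp)))
      (Submodule.smul_mem _ _ (Submodule.subset_span (by simp)))
  have hspan := rank_span_finset_le (R := Kᵐᵒᵖ) ({a, c} : Finset L)
  rw [htop, rank_top] at hspan
  exact hspan.trans (by exact_mod_cast Finset.card_le_two)

theorem rank_le_one_of_isMinimal (hX : X.IsProper)
    (hmin : X.toInvolutorySet.IsMinimal) : Module.rank Kᵐᵒᵖ L ≤ 1 := by
  have := hmin.charP_two
  have hf {a : L} (ha : a ≠ 0) : X.f a a = 1 := by
    have hq : star (X.q a) ≠ X.q a := fun h => ha ((X.q_mem_iff a).1 (hmin.mem_of_star_eq h))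
    rw [X.f_self, CharTwo.sub_eq_add, hmin.add_star_eq_one hq]
  obtain ⟨a, ha⟩ := @exists_ne L hX.nontrivial 0
  refine rank_le_one_of_forall_f_eq_zero (X := X) (a := a) (by simp [hf ha]) fun d had => ?_
  by_contra hd
  have hda : X.f d a = 0 := by rw [← neg_eq_zero, ← X.star_f, had, star_zero]
  have had0 : a + d ≠ 0 := fun h0 => by
    simpa [X.f_add_right, had, hf ha, X.f_zero_right] using congrArg (X.f a) h0
  simpa [X.f_add_left, X.f_add_right, had, hda, hf ha, hf hd, CharTwo.add_self_eq_zero] using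
    hf had0

end Rank

/-- A Jordan isomorphism between the groups of two proper pseudo-quadratic spaces. -/
structure IsProperJordanIso (γ : X.T ≃* X'.T) : Prop where
  proper : X.IsProper
  proper' : X'.IsProper
  jordan : IsJordanIso γ

namespace IsProperJordanIso

variable {γ : X.T ≃* X'.T}

theorem symm (h : IsProperJordanIso γ) : IsProperJordanIso γ.symm where
  proper := h.proper'
  proper' := h.proper
  jordan :=
    { map_unit := by rw [MulEquiv.symm_apply_eq, h.jordan.map_unit]
      map_hua := fun x y => by simp [MulEquiv.symm_apply_eq, h.jordan.map_hua] }

theorem vec_map_ofK₀ (h : IsProperJordanIso γ) (k : X.K₀) : (γ (T.ofK₀ k)).vec = 0 := by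
  have hk : T.ofK₀ k ∈ Subgroup.center X.T := (mem_center_iff h.proper).2 rfl
  rw [← mem_center_iff h.proper', Subgroup.mem_center_iff] at *
  exact γ.surjective.forall.2 fun g => by rw [← map_mul, hk, map_mul]

theorem vec_map_congr (h : IsProperJordanIso γ) {x y : X.T} (hxy : x.vec = y.vec) :
    (γ x).vec = (γ y).vec := by
  obtain ⟨k, rfl⟩ := T.exists_eq_mul_ofK₀ hxy
  simp [h.vec_map_ofK₀]

/-- The isomorphism `L ≃ L'` induced by `γ` on the quotients of `T` and `T'` by their centers. -/
def vecEquiv (h : IsProperJordanIso γ) : L ≃+ L' where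
  toFun a := (γ (T.ofVec X a)).vec
  invFun a := (γ.symm (T.ofVec X' a)).vec
  left_inv a := (h.symm.vec_map_congr (x := T.ofVec X' (γ (T.ofVec X a)).vec)
    (y := γ (T.ofVec X a)) rfl).trans (by simp)
  right_inv a := (h.vec_map_congr (x := T.ofVec X (γ.symm (T.ofVec X' a)).vec)
    (y := γ.symm (T.ofVec X' a)) rfl).trans (by simp)
  map_add' a b := (h.vec_map_congr (x := T.ofVec X (a + b))
    (y := T.ofVec X a * T.ofVec X b) rfl).trans (by simp)

/-- The isomorphism `K₀ ≃ K₀'` induced by `γ` on the centers of `T` and `T'`. -/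
def centerEquiv (h : IsProperJordanIso γ) : X.K₀ ≃+ X'.K₀ where
  toFun k := ⟨(γ (T.ofK₀ k)).scal, T.scal_mem_of_vec_eq_zero (h.vec_map_ofK₀ k)⟩
  invFun k := ⟨(γ.symm (T.ofK₀ k)).scal, T.scal_mem_of_vec_eq_zero (h.symm.vec_map_ofK₀ k)⟩
  left_inv k := Subtype.ext <| by
    have hk := T.ext (x := T.ofK₀ ⟨_, T.scal_mem_of_vec_eq_zero (h.vec_map_ofK₀ k)⟩)
      (h.vec_map_ofK₀ k).symm rfl
    simp [hk]
  right_inv k := Subtype.ext <| by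
    have hk := T.ext (x := T.ofK₀ ⟨_, T.scal_mem_of_vec_eq_zero (h.symm.vec_map_ofK₀ k)⟩)
      (h.symm.vec_map_ofK₀ k).symm rfl
    simp [hk]
  map_add' k l := Subtype.ext <| by
    have hkl : T.ofK₀ (k + l) = (T.ofK₀ k * T.ofK₀ l : X.T) :=
      T.ext (by simp) (by rw [T.scal_mul_ofK₀]; rfl)
    simp [hkl, h.vec_map_ofK₀, X'.f_zero_left]

theorem symm_vecEquiv (h : IsProperJordanIso γ) : h.symm.vecEquiv = h.vecEquiv.symm := rfl

theorem vec_map (h : IsProperJordanIso γ) (x : X.T) : (γ x).vec = h.vecEquiv x.vec :=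
  h.vec_map_congr rfl

theorem map_ofK₀ (h : IsProperJordanIso γ) (k : X.K₀) : γ (T.ofK₀ k) = T.ofK₀ (h.centerEquiv k) :=
  T.ext (h.vec_map_ofK₀ k) rfl

theorem scal_map_mul_ofK₀ (h : IsProperJordanIso γ) (x : X.T) (k : X.K₀) :
    (γ (x * T.ofK₀ k)).scal = (γ x).scal + h.centerEquiv k := by
  rw [map_mul, h.map_ofK₀, T.scal_mul_ofK₀]

theorem centerEquiv_one (h : IsProperJordanIso γ) :
    h.centerEquiv ⟨1, X.one_mem⟩ = ⟨1, X'.one_mem⟩ :=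
  Subtype.ext (congrArg T.scal h.jordan.map_unit)

theorem centerEquiv_eq_one_iff (h : IsProperJordanIso γ) {k : X.K₀} :
    (h.centerEquiv k : K') = 1 ↔ (k : K) = 1 := by
  have h1 : (h.centerEquiv k : K') = 1 ↔ h.centerEquiv k = h.centerEquiv ⟨1, X.one_mem⟩ := by
    rw [h.centerEquiv_one, Subtype.ext_iff]
  rw [h1, h.centerEquiv.apply_eq_iff_eq, Subtype.ext_iff]

theorem vecEquiv_smul (h : IsProperJordanIso γ) (b : L) (k : X.K₀) :
    h.vecEquiv (b <• (k : K)) = h.vecEquiv b <• (h.centerEquiv k : K') := by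
  have hk := congrArg T.vec (h.jordan.map_hua (T.ofK₀ k) (T.ofVec X b))
  simpa [h.vec_map, h.map_ofK₀, T.hua, X.star_eq _ k.2, X'.star_eq _ (h.centerEquiv k).2] using hk

theorem vecEquiv_hua (h : IsProperJordanIso γ) (x : X.T) (b : L) :
    h.vecEquiv (b <• star x.scal - x.vec <• (x.scal⁻¹ * X.f x.vec b * star x.scal)) =
      h.vecEquiv b <• star (γ x).scal - h.vecEquiv x.vec <•
        ((γ x).scal⁻¹ * X'.f (h.vecEquiv x.vec) (h.vecEquiv b) * star (γ x).scal) := by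
  have hx := congrArg T.vec (h.jordan.map_hua x (T.ofVec X b))
  rw [h.vec_map] at hx
  simpa only [T.hua, h.vec_map, T.vec_ofVec] using hx

theorem centerEquiv_conj (h : IsProperJordanIso γ) (x : X.T) (v : X.K₀) :
    (h.centerEquiv ⟨x.scal * v * star x.scal, X.mul_mul_star_mem _ v.2⟩ : K') =
      (γ x).scal * h.centerEquiv v * star (γ x).scal := by
  have hx : x.hua (T.ofK₀ v) = T.ofK₀ ⟨x.scal * v * star x.scal, X.mul_mul_star_mem _ v.2⟩ :=
    T.ext (by simp [T.hua, X.f_zero_right]) rfl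
  have hγ := congrArg T.scal (h.jordan.map_hua x (T.ofK₀ v))
  rwa [hx, h.map_ofK₀, h.map_ofK₀] at hγ

theorem centerEquiv_norm (h : IsProperJordanIso γ) (x : X.T) :
    h.centerEquiv (X.norm x.scal) = X'.norm (γ x).scal := by
  have hx := h.centerEquiv_conj x ⟨1, X.one_mem⟩
  simp only [h.centerEquiv_one, mul_one] at hx
  exact Subtype.ext hx

theorem centerEquiv_trace (h : IsProperJordanIso γ) (x : X.T) :
    h.centerEquiv (X.trace x.scal) = X'.trace (γ x).scal := by
  have hx := h.centerEquiv_norm (x * T.ofK₀ ⟨1, X.one_mem⟩)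
  rw [h.scal_map_mul_ofK₀, T.scal_mul_ofK₀, h.centerEquiv_one,
    InvolutorySet.norm_add_one, InvolutorySet.norm_add_one] at hx
  simpa only [map_add, h.centerEquiv_one, h.centerEquiv_norm, add_left_inj, add_right_inj] using hx

theorem centerEquiv_trace_f (h : IsProperJordanIso γ) (a b : L) :
    h.centerEquiv (X.trace (X.f a b)) = X'.trace (X'.f (h.vecEquiv a) (h.vecEquiv b)) := by
  have hab : T.ofVec X b * T.ofVec X a =
      T.ofVec X a * T.ofVec X b * T.ofK₀ (X.trace (X.f a b)) := by
    refine T.ext (by simp [add_comm]) ?_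
    rw [T.scal_mul_ofK₀]
    simp only [T.scal_mul, T.vec_ofVec, InvolutorySet.coe_trace, X.star_f]
    abel
  have hγ := congrArg (fun z => (γ z).scal) hab
  simp only [h.scal_map_mul_ofK₀] at hγ
  simp only [map_mul, T.scal_mul, h.vec_map, T.vec_ofVec] at hγ
  refine Subtype.ext ?_
  rw [InvolutorySet.coe_trace, X'.star_f]
  linear_combination (norm := abel) -hγ

theorem exists_iso (h : IsProperJordanIso γ) (ϕ : K →+* K')
    (hϕ : ∀ a x, h.vecEquiv (a <• x) = h.vecEquiv a <• ϕ x)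
    (hscal : ∀ x : X.T, (γ x).scal = ϕ x.scal) : ∃ Φ : Iso X X', Φ.Induces γ := by
  have hK₀ (k : X.K₀) : ϕ k = h.centerEquiv k := (hscal (T.ofK₀ k)).symm
  have hf (a b : L) : ϕ (X.f a b) = X'.f (h.vecEquiv a) (h.vecEquiv b) := by
    have hab := hscal (T.ofVec X b * T.ofVec X a)
    simp only [map_mul, T.scal_mul, map_add, hscal, h.vec_map, T.vec_ofVec] at hab
    exact (add_left_cancel hab).symm
  obtain ⟨a, ha⟩ := @exists_ne L h.proper.nontrivial 0
  have hsurj : Function.Surjective ϕ := fun y => by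
    obtain ⟨b, rfl⟩ := f_surjective h.proper' (h.vecEquiv.map_ne_zero_iff.2 ha) y
    exact ⟨X.f a (h.vecEquiv.symm b), by rw [hf, AddEquiv.apply_symm_apply]⟩
  have hbij : Function.Bijective ϕ := ⟨ϕ.injective, hsurj⟩
  refine ⟨{
    vec := h.vecEquiv
    scal := RingEquiv.ofBijective ϕ hbij
    map_smul := hϕ
    map_star := fun x => ?_
    map_K₀ := Set.Subset.antisymm ?_ fun k hk => ?_
    map_q := fun b => ?_ }, fun x => ⟨h.vec_map x, hscal x⟩⟩
  · obtain ⟨b, rfl⟩ := f_surjective h.proper ha x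
    rw [X.star_f, map_neg]
    change -ϕ (X.f b a) = star (ϕ (X.f a b))
    rw [hf, hf, X'.star_f]
  · rintro _ ⟨k, hk, rfl⟩
    exact hK₀ ⟨k, hk⟩ ▸ (h.centerEquiv _).2
  · exact ⟨h.centerEquiv.symm ⟨k, hk⟩, (h.centerEquiv.symm _).2,
      (hK₀ _).trans (by rw [AddEquiv.apply_symm_apply])⟩
  · have hb := (γ (T.ofVec X b)).mem
    rw [hscal, h.vec_map, ← neg_mem_iff, neg_sub] at hb
    exact hb

theorem coe_centerEquiv_eq (h : IsProperJordanIso γ) {ϕ : K → K'}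
    (hϕ : ∀ a x, h.vecEquiv (a <• x) = h.vecEquiv a <• ϕ x) (k : X.K₀) :
    (h.centerEquiv k : K') = ϕ k := by
  obtain ⟨a, ha⟩ := @exists_ne L h.proper.nontrivial 0
  exact op_injective (smul_left_injective _ (h.vecEquiv.map_ne_zero_iff.2 ha)
    ((h.vecEquiv_smul a k).symm.trans (hϕ a k)))

theorem scal_defect_mul_mul (h : IsProperJordanIso γ) {ϕ : K →+* K'}
    (hϕ : ∀ a x, h.vecEquiv (a <• x) = h.vecEquiv a <• ϕ x)
    (hstar : ∀ x, ϕ (star x) = star (ϕ x)) (x : X.T) {k v : K} (hk : k ∈ X.K₀) (hv : v ∈ X.K₀) :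
    ((γ x).scal - ϕ x.scal) * ϕ v * ϕ k = ϕ k * ϕ v * ((γ x).scal - ϕ x.scal) := by
  have hconj (z : X.T) {v : K} (hv : v ∈ X.K₀) :
      (γ z).scal * ϕ v * star (γ z).scal = ϕ z.scal * ϕ v * star (ϕ z.scal) := by
    have hz := h.centerEquiv_conj z ⟨v, hv⟩
    rw [h.coe_centerEquiv_eq hϕ, h.coe_centerEquiv_eq hϕ, map_mul, map_mul, hstar] at hz
    exact hz.symm
  set e := (γ x).scal - ϕ x.scal with he
  have polarized {k v : K} (hk : k ∈ X.K₀) (hv : v ∈ X.K₀) :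
      e * ϕ v * ϕ k + ϕ k * ϕ v * star e = 0 := by
    have hxk := hconj (x * T.ofK₀ ⟨k, hk⟩) hv
    have hk' : star (ϕ k) = ϕ k := by rw [← hstar, X.star_eq k hk]
    rw [T.scal_mul_ofK₀, h.scal_map_mul_ofK₀, h.coe_centerEquiv_eq hϕ, map_add, star_add, star_add,
      hk'] at hxk
    rw [he, star_sub]
    linear_combination (norm := noncomm_ring) hxk - hconj x hv
  have hse : star e = -e := by
    have h11 := polarized X.one_mem X.one_mem
    simp only [map_one, mul_one, one_mul] at h11
    exact eq_neg_of_add_eq_zero_right h11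
  have hkv := polarized hk hv
  rwa [hse, mul_neg, ← sub_eq_add_neg, sub_eq_zero] at hkv

theorem coe_centerEquiv_mem_intertwiners (h : IsProperJordanIso γ) (k : X.K₀) :
    ((k : K), (h.centerEquiv k : K')) ∈ intertwiners K K' h.vecEquiv :=
  fun b => h.vecEquiv_smul b k

theorem trace_mem_intertwiners (h : IsProperJordanIso γ) (x : X.T) :
    (x.scal + star x.scal, (γ x).scal + star (γ x).scal) ∈ intertwiners K K' h.vecEquiv := by
  simpa only [h.centerEquiv_trace, InvolutorySet.coe_trace] using
    h.coe_centerEquiv_mem_intertwiners (X.trace x.scal)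

theorem norm_mem_intertwiners (h : IsProperJordanIso γ) (x : X.T) :
    (x.scal * star x.scal, (γ x).scal * star (γ x).scal) ∈ intertwiners K K' h.vecEquiv := by
  simpa only [h.centerEquiv_norm, InvolutorySet.coe_norm] using
    h.coe_centerEquiv_mem_intertwiners (X.norm x.scal)

theorem coe_K₀_subset_map_fst_intertwiners (h : IsProperJordanIso γ) :
    (X.K₀ : Set K) ⊆ (intertwiners K K' h.vecEquiv).map (RingHom.fst K K') :=
  fun k hk => ⟨_, h.coe_centerEquiv_mem_intertwiners ⟨k, hk⟩, rfl⟩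

theorem exists_iso_of_isProperInvolutorySet (h : IsProperJordanIso γ)
    (hS : X.toInvolutorySet.IsProperInvolutorySet) : ∃ Φ : Iso X X', Φ.Induces γ := by
  have := h.proper'.nontrivial
  obtain ⟨ϕ, hϕ⟩ := exists_ringHom_of_map_fst_intertwiners_eq_top h.vecEquiv
    (top_unique (hS.2 ▸ Subring.closure_le.2 h.coe_K₀_subset_map_fst_intertwiners))
  have hstar : ∀ x, ϕ (star x) = star (ϕ x) := map_star_of_closure_eq_top ϕ hS.2 fun k hk => by
    rw [X.star_eq k hk, ← h.coe_centerEquiv_eq hϕ ⟨k, hk⟩, X'.star_eq _ (h.centerEquiv _).2]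
  refine h.exists_iso ϕ hϕ fun x => ?_
  obtain ⟨k, hk, l, hl, hkl⟩ := hS.exists_not_commute
  have hek := h.scal_defect_mul_mul hϕ hstar x hk X.one_mem
  have hel := h.scal_defect_mul_mul hϕ hstar x hl X.one_mem
  have hekl := h.scal_defect_mul_mul hϕ hstar x hk hl
  by_contra hne
  refine hkl (ϕ.injective (mul_left_cancel₀ (sub_ne_zero.2 hne) ?_))
  simp only [map_one, mul_one] at hek hel
  rw [map_mul, map_mul]
  linear_combination (norm := noncomm_ring) hek * ϕ l + ϕ k * hel - hekl

theorem isCentral_target (h : IsProperJordanIso γ)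
    (hZ : X.toInvolutorySet.IsCentral) : X'.toInvolutorySet.IsCentral := by
  by_contra hZ'
  have hS : X'.toInvolutorySet.IsProperInvolutorySet :=
    ⟨h.proper'.star_ne, not_not.1 (mt X'.isCentral_of_closure_ne_top hZ')⟩
  obtain ⟨k, hk, l, -, hkl⟩ := hS.exists_not_commute
  obtain ⟨Φ, -⟩ := h.symm.exists_iso_of_isProperInvolutorySet hS
  have hΦk : Φ.scal k ∈ (X.K₀ : Set K) := Φ.map_K₀ ▸ Set.mem_image_of_mem _ hk
  exact hkl (Φ.scal.injective (by rw [map_mul, map_mul, hZ _ hΦk]))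

end IsProperJordanIso

/-- A Jordan isomorphism between proper pseudo-quadratic spaces for which `K₀` is central and not
equal to `{0, 1}`. -/
structure IsCentralJordanIso (γ : X.T ≃* X'.T) : Prop extends IsProperJordanIso γ where
  central : X.toInvolutorySet.IsCentral
  not_isMinimal : ¬ X.toInvolutorySet.IsMinimal

variable {γ : X.T ≃* X'.T}

namespace IsCentralJordanIso

theorem central' (h : IsCentralJordanIso γ) : X'.toInvolutorySet.IsCentral :=
  h.isCentral_target h.central

theorem symm (h : IsCentralJordanIso γ) : IsCentralJordanIso γ.symm where
  toIsProperJordanIso := h.toIsProperJordanIso.symm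
  central := h.central'
  not_isMinimal hmin := h.not_isMinimal fun k hk =>
    (hmin _ (h.centerEquiv ⟨k, hk⟩).2).imp (by simp) h.centerEquiv_eq_one_iff.1

theorem mul_mem (h : IsCentralJordanIso γ) {k l : K} (hk : k ∈ X.K₀) (hl : l ∈ X.K₀) :
    k * l ∈ X.K₀ := h.central.mul_mem h.proper.star_ne hk hl

theorem vecEquiv_star_smul_sub_smul_norm (h : IsCentralJordanIso γ) (x : X.T) (b : L) :
    (h.vecEquiv (b <• star x.scal) - h.vecEquiv b <• star (γ x).scal) <•
        ((γ x).scal * star (γ x).scal) =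
      h.vecEquiv (x.vec <• (star x.scal * X.f x.vec b * star x.scal)) - h.vecEquiv x.vec <•
        (star (γ x).scal * X'.f (h.vecEquiv x.vec) (h.vecEquiv b) * star (γ x).scal) := by
  have hN := h.norm_mem_intertwiners x
  have hx := h.vecEquiv_hua x b
  rw [map_sub, sub_eq_sub_iff_sub_eq_sub] at hx
  rw [hx, smul_sub, ← hN, ← op_smul_mul, ← op_smul_mul, mul_assoc x.scal⁻¹, mul_assoc (γ x).scal⁻¹,
    h.central.inv_mul_mul_norm, h.central'.inv_mul_mul_norm, mul_assoc, mul_assoc]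

/-- Polarize `vecEquiv_star_smul_sub_smul_norm` by replacing `(a, t)` with `(a, t + k)`: comparing
the coefficients of the resulting quadratic polynomial in `k ∈ K₀` gives the claim. -/
theorem vecEquiv_star_smul_sub (h : IsCentralJordanIso γ) (x : X.T) (b : L) :
    h.vecEquiv (b <• star x.scal) - h.vecEquiv b <• star (γ x).scal =
      h.vecEquiv (x.vec <• X.f x.vec b) -
        h.vecEquiv x.vec <• X'.f (h.vecEquiv x.vec) (h.vecEquiv b) := by
  obtain ⟨m, hm, hm0, hm1⟩ : ∃ m ∈ X.K₀, m ≠ 0 ∧ m ≠ 1 := by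
    simpa [InvolutorySet.IsMinimal] using h.not_isMinimal
  set φ := h.vecEquiv
  set a := x.vec
  set t := x.scal
  set s := (γ x).scal
  set u := X.f a b
  set u' := X'.f (φ a) (φ b)
  set δ := φ (b <• star t) - φ b <• star s
  have polarized (k : X.K₀) :
      δ <• (s * star s) - (φ (a <• (star t * u * star t)) - φ a <• (star s * u' * star s)) +
        (δ <• (s + star s) - (φ (a <• (u * star t + star t * u)) -
          φ a <• (u' * star s + star s * u'))) <• (h.centerEquiv k : K') +
        (δ - (φ (a <• u) - φ a <• u')) <• ((h.centerEquiv k : K') * h.centerEquiv k) = 0 := by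
    set k' := (h.centerEquiv k : K')
    have hk' : k' ∈ X'.K₀ := (h.centerEquiv k).2
    have hφk (b : L) : φ (b <• (k : K)) = φ b <• k' := h.vecEquiv_smul b k
    have hxk : (φ (b <• (star t + k)) - φ b <• (star s + k')) <• ((s + k') * (star s + k')) =
        φ (a <• ((star t + k) * u * (star t + k))) -
          φ a <• ((star s + k') * u' * (star s + k')) := by
      have hxk := h.vecEquiv_star_smul_sub_smul_norm (x * T.ofK₀ k) b
      rwa [T.scal_mul_ofK₀, h.scal_map_mul_ofK₀, T.vec_mul, T.vec_ofK₀, add_zero, star_add,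
        star_add, X.star_eq k k.2, X'.star_eq k' hk'] at hxk
    have hNk : (s + k') * (star s + k') = s * star s + (s + star s) * k' + k' * k' := by
      linear_combination (norm := noncomm_ring) h.central' k' hk' (star s)
    rw [hNk, add_mul_mul_add_of_forall_commute (h.central k k.2),
      add_mul_mul_add_of_forall_commute (h.central' k' hk')] at hxk
    simp only [op_add, add_smul, map_add, smul_add, smul_sub, op_smul_mul _ _ (k : K),
      op_smul_mul _ _ k', op_smul_mul _ _ ((k : K) * k), hφk, δ] at hxk ⊢
    linear_combination (norm := skip) hxk
    simp only [op_smul_mul]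
    abel
  refine sub_eq_zero.1 (eq_zero_of_quadratic_eq_zero (m := (h.centerEquiv ⟨m, hm⟩ : K')) ?_ ?_ ?_ ?_
    (polarized ⟨m, hm⟩))
  · simpa using hm0
  · exact mt h.centerEquiv_eq_one_iff.1 hm1
  · simpa using polarized 0
  · simpa [h.centerEquiv_one] using polarized ⟨1, X.one_mem⟩

theorem vecEquiv_smul_star_scal (h : IsCentralJordanIso γ) (x : X.T) :
    h.vecEquiv (x.vec <• star x.scal) = h.vecEquiv x.vec <• star (γ x).scal := by
  have hT := h.trace_mem_intertwiners x
  have hδ := h.vecEquiv_star_smul_sub x x.vec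
  have hδN := h.vecEquiv_star_smul_sub_smul_norm x x.vec
  have hcomm := h.central'.star_mul_self (γ x).scal
  have hf' : X'.f (h.vecEquiv x.vec) (h.vecEquiv x.vec) = (γ x).scal - star (γ x).scal := by
    rw [← h.vec_map, (γ x).f_self]
  rw [hf', x.f_self] at hδ hδN
  rw [map_smul_mul_sub_mul_self_sub (h.central.star_mul_self x.scal).symm hcomm.symm hT
    (h.norm_mem_intertwiners x)] at hδN
  by_contra! hne
  have hcancel {y z : K'} (hyz : (h.vecEquiv (x.vec <• star x.scal) -
      h.vecEquiv x.vec <• star (γ x).scal) <• y = (h.vecEquiv (x.vec <• star x.scal) -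
      h.vecEquiv x.vec <• star (γ x).scal) <• z) : y = z :=
    op_injective (smul_left_injective _ (sub_ne_zero.2 hne) hyz)
  have h3 : (3 : K') = 0 := by
    refine hcancel ?_
    have hTx := hT x.vec
    simp only [op_add, op_sub, add_smul, sub_smul, map_add, map_sub] at hTx hδ
    rw [← two_add_one_eq_three, ← one_add_one_eq_two]
    simp only [op_add, op_one, op_zero, one_smul, add_smul, zero_smul]
    linear_combination (norm := abel) hδ + hTx
  have hs : (γ x).scal - star (γ x).scal = 0 := mul_self_eq_zero.1 <| by
    linear_combination (norm := noncomm_ring)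
      hcancel hδN - h3 * ((γ x).scal * star (γ x).scal) - 2 * hcomm
  have hmem : (γ x).scal ∈ X'.K₀ := by
    have hs' : (γ x).scal = -((γ x).scal + star (γ x).scal) := by
      linear_combination (norm := noncomm_ring) h3 * (γ x).scal - hs
    exact hs' ▸ neg_mem (X'.add_star_mem _)
  have hvec : x.vec = 0 := by
    have hvec' : (γ x).vec = 0 := T.vec_eq_zero_of_scal_mem hmem
    rwa [h.vec_map, map_eq_zero_iff _ h.vecEquiv.injective] at hvec'
  exact hne (by simp [hvec])

theorem vecEquiv_smul_scal (h : IsCentralJordanIso γ) (x : X.T) :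
    h.vecEquiv (x.vec <• x.scal) = h.vecEquiv x.vec <• (γ x).scal := by
  have hT := h.trace_mem_intertwiners x x.vec
  simpa only [op_add, add_smul, map_add, h.vecEquiv_smul_star_scal, add_left_inj] using hT

theorem vecEquiv_smul_add (h : IsCentralJordanIso γ) (x : X.T) (b : L) :
    h.vecEquiv (b <• x.scal) + h.vecEquiv (x.vec <• X.f x.vec b) =
      h.vecEquiv b <• (γ x).scal +
        h.vecEquiv x.vec <• X'.f (h.vecEquiv x.vec) (h.vecEquiv b) := by
  have hT := h.trace_mem_intertwiners x b
  simp only [op_add, add_smul, map_add] at hT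
  linear_combination (norm := abel) hT - h.vecEquiv_star_smul_sub x b

theorem star_scal_ne (h : IsCentralJordanIso γ) {x : X.T} (hx : star x.scal ≠ x.scal) :
    star (γ x).scal ≠ (γ x).scal := by
  intro hs
  have hst := h.vecEquiv_smul_star_scal x
  rw [hs, ← h.vecEquiv_smul_scal, h.vecEquiv.injective.eq_iff] at hst
  exact hx (op_injective (smul_left_injective _ (T.vec_ne_zero hx) hst))

theorem semiconjBy_f_iff (h : IsCentralJordanIso γ) {x : X.T} (hx : star x.scal ≠ x.scal) {b : L} :
    SemiconjBy (X'.f (h.vecEquiv x.vec) (h.vecEquiv b)) (star (γ x).scal) (γ x).scal ↔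
      SemiconjBy (X.f x.vec b) (star x.scal) x.scal := by
  rw [h.central'.semiconjBy_star_iff (h.star_scal_ne hx), h.central.semiconjBy_star_iff hx,
    ← X'.f_smul_left, ← X.f_smul_left, ← h.vecEquiv_smul_scal, ← h.centerEquiv_trace_f,
    ← h.centerEquiv_trace_f, map_eq_zero_iff _ h.centerEquiv.injective,
    map_eq_zero_iff _ h.centerEquiv.injective]

theorem vecEquiv_skew_smul_star (h : IsCentralJordanIso γ) (x : X.T) {j : K}
    (hj : SemiconjBy j (star x.scal) x.scal) :
    h.vecEquiv (x.vec <• j <• star x.scal) = h.vecEquiv (x.vec <• j) <• (γ x).scal +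
      h.vecEquiv x.vec <• X'.f (h.vecEquiv x.vec) (h.vecEquiv (x.vec <• j)) := by
  have hjt : j * star x.scal = j * x.scal + (x.scal - star x.scal) * j := by
    linear_combination (norm := noncomm_ring) hj.eq - (h.central.semiconjBy_symm hj).eq
  rw [← h.vecEquiv_smul_add, ← map_add, ← op_smul_mul, ← op_smul_mul, ← add_smul, ← op_add,
    X.f_smul_right, x.f_self, hjt]

theorem exists_vecEquiv_smul_star_eq (h : IsCentralJordanIso γ) (x : X.T) {j : K} (hj0 : j ≠ 0)
    (hj : SemiconjBy j (star x.scal) x.scal) :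
    ∃ u : K', h.vecEquiv (x.vec <• j <• star x.scal) = h.vecEquiv (x.vec <• j) <• u := by
  set n := X.norm (star j)
  have hn : (n : K) = star j * j := by simp [n]
  have hn0 : (h.centerEquiv n : K') ≠ 0 := by simpa [← Subtype.val_inj (a := n), hn] using hj0
  have hjn : star j * x.scal * j = star x.scal * n := by
    rw [mul_assoc, ← hj.eq, ← mul_assoc, ← hn, h.central _ n.2]
  have hx := h.vecEquiv_smul_scal (x.smul j)
  rw [T.vec_smul, T.scal_smul, hjn, op_smul_mul, h.vecEquiv_smul] at hx
  refine ⟨(γ (x.smul j)).scal * (h.centerEquiv n : K')⁻¹, ?_⟩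
  rw [op_smul_mul, ← hx, ← op_smul_mul (h.vecEquiv _), mul_inv_cancel₀ hn0, op_one, one_smul]

theorem vecEquiv_skew_smul_star_of_f_ne_zero (h : IsCentralJordanIso γ) {x : X.T}
    (hx : star x.scal ≠ x.scal) {j : K} (hj : SemiconjBy j (star x.scal) x.scal)
    (hf : X'.f (h.vecEquiv x.vec) (h.vecEquiv (x.vec <• j)) ≠ 0) :
    h.vecEquiv (x.vec <• j <• star x.scal) =
      h.vecEquiv (x.vec <• j) <• star (γ x).scal := by
  have hj0 : j ≠ 0 := by
    rintro rfl
    simp [X'.f_zero_right] at hf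
  have hc := (h.semiconjBy_f_iff hx).2 (semiconjBy_f_smul h.central x hj)
  have hb := h.vecEquiv_skew_smul_star x hj
  obtain ⟨u, hu⟩ := h.exists_vecEquiv_smul_star_eq x hj0 hj
  rw [hu] at hb ⊢
  have hfb := congrArg (X'.f (h.vecEquiv x.vec)) hb
  rw [X'.f_add_right, X'.f_smul_right, X'.f_smul_right, X'.f_smul_right, ← h.vec_map x,
    (γ x).f_self, h.vec_map] at hfb
  have hus : u = star (γ x).scal := mul_left_cancel₀ hf <| by
    linear_combination (norm := noncomm_ring) hfb + (h.central'.semiconjBy_symm hc).eq - hc.eq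
  rw [hus]

theorem vecEquiv_skew_smul_scal_of_f_ne_zero (h : IsCentralJordanIso γ) {x : X.T}
    (hx : star x.scal ≠ x.scal) {j : K} (hj : SemiconjBy j (star x.scal) x.scal)
    (hf : X'.f (h.vecEquiv x.vec) (h.vecEquiv (x.vec <• j)) ≠ 0) :
    h.vecEquiv (x.vec <• j <• x.scal) = h.vecEquiv (x.vec <• j) <• (γ x).scal := by
  have hT := h.trace_mem_intertwiners x (x.vec <• j)
  simpa only [op_add, add_smul, map_add, h.vecEquiv_skew_smul_star_of_f_ne_zero hx hj hf,
    add_left_inj] using hT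

theorem exists_semiconjBy_vecEquiv_smul_eq (h : IsCentralJordanIso γ) {x : X.T}
    (hx : star x.scal ≠ x.scal) {j : K} (hj : SemiconjBy j (star x.scal) x.scal)
    (hf : X'.f (h.vecEquiv x.vec) (h.vecEquiv (x.vec <• j)) ≠ 0) :
    ∃ j', SemiconjBy j' (star (γ x).scal) (γ x).scal ∧
      h.vecEquiv (x.vec <• j) = h.vecEquiv x.vec <• j' := by
  have hd : star (γ x).scal - (γ x).scal ≠ 0 := sub_ne_zero.2 (h.star_scal_ne hx)
  have hc := (h.semiconjBy_f_iff hx).2 (semiconjBy_f_smul h.central x hj)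
  have hb := h.vecEquiv_skew_smul_star x hj
  rw [h.vecEquiv_skew_smul_star_of_f_ne_zero hx hj hf] at hb
  refine ⟨X'.f (h.vecEquiv x.vec) (h.vecEquiv (x.vec <• j)) * (star (γ x).scal - (γ x).scal)⁻¹,
    SemiconjBy.mul_left hc (Commute.inv_left₀ ?_), ?_⟩
  · exact (Commute.refl _).sub_left (h.central'.star_mul_self (γ x).scal).symm
  · rw [op_smul_mul, ← sub_eq_iff_eq_add'.2 hb, ← sub_smul, ← op_sub, ← op_smul_mul,
      mul_inv_cancel₀ hd, op_one, one_smul]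

theorem vecEquiv_smul_scal_of_f_eq_zero (h : IsCentralJordanIso γ) {x : X.T} {b : L}
    (hb : X.f x.vec b = 0) (hb' : X'.f (h.vecEquiv x.vec) (h.vecEquiv b) = 0) :
    h.vecEquiv (b <• x.scal) = h.vecEquiv b <• (γ x).scal := by
  simpa [hb, hb'] using h.vecEquiv_smul_add x b

theorem vecEquiv_smul_smul_scal_of_commute (h : IsCentralJordanIso γ) {x : X.T}
    (hx : star x.scal ≠ x.scal) {w : K} (hw : Commute w x.scal) :
    h.vecEquiv (x.vec <• w <• x.scal) = h.vecEquiv (x.vec <• w) <• (γ x).scal := by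
  obtain ⟨k, l, rfl⟩ := h.central.exists_eq_add_mul_of_commute hx hw
  have htt : h.vecEquiv (x.vec <• x.scal <• x.scal) =
      h.vecEquiv x.vec <• (γ x).scal <• (γ x).scal := by
    have hT := h.trace_mem_intertwiners x (x.vec <• x.scal)
    have hN := h.norm_mem_intertwiners x x.vec
    simp only [op_add, op_smul_mul, add_smul, map_add, h.vecEquiv_smul_scal] at hT hN
    rwa [hN, add_left_inj] at hT
  rw [h.central _ l.2, op_add, add_smul, smul_add, op_smul_mul, ← op_smul_mul x.vec,
    h.central _ k.2, op_smul_mul, ← op_smul_mul _ _ x.scal, h.central _ l.2, op_smul_mul]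
  simp only [map_add, smul_add, h.vecEquiv_smul, htt, h.vecEquiv_smul_scal]
  simp only [← op_smul_mul, h.central' _ (Subtype.prop _), mul_assoc]

/-- A vector `c` orthogonal to `a` whose image is `φ(a) j'` for some `j' ≠ 0` with `j' s^σ = s j'`,
where `x = (a, t)` and `γ x = (φ(a), s)`. Such a vector keeps `γ` from being induced by an
isomorphism, which would preserve orthogonality. -/
structure IsObstruction (h : IsCentralJordanIso γ) (x : X.T) (j' : K') (c : L) : Prop where
  star_ne : star x.scal ≠ x.scal
  ne_zero : j' ≠ 0
  skew : SemiconjBy j' (star (γ x).scal) (γ x).scal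
  map_eq : h.vecEquiv c = h.vecEquiv x.vec <• j'
  f_eq_zero : X.f x.vec c = 0

namespace IsObstruction

variable {h : IsCentralJordanIso γ} {x : X.T} {j' : K'} {c : L}

theorem vecEquiv_smul_scal (ho : h.IsObstruction x j' c) :
    h.vecEquiv (c <• x.scal) = h.vecEquiv c <• star (γ x).scal := by
  have hc := h.vecEquiv_smul_add x c
  have hj : j' * (γ x).scal + ((γ x).scal - star (γ x).scal) * j' = j' * star (γ x).scal := by
    linear_combination (norm := noncomm_ring)
      (h.central'.semiconjBy_symm ho.skew).eq - ho.skew.eq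
  rw [ho.f_eq_zero, op_zero, zero_smul, map_zero, add_zero] at hc
  rw [hc, ho.map_eq, X'.f_smul_right, ← h.vec_map, (γ x).f_self, ← op_smul_mul, ← op_smul_mul,
    ← add_smul, ← op_add, hj]

theorem vec_ne_zero (ho : h.IsObstruction x j' c) : c ≠ 0 := by
  have hc : h.vecEquiv c ≠ 0 := by
    rw [ho.map_eq, ne_eq, smul_eq_zero, op_eq_zero_iff, not_or]
    exact ⟨ho.ne_zero, h.vecEquiv.map_ne_zero_iff.2 (T.vec_ne_zero ho.star_ne)⟩
  exact h.vecEquiv.map_ne_zero_iff.1 hc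

theorem exists_scal_eq (ho : h.IsObstruction x j' c) : ∃ β k : X.K₀,
    (h.centerEquiv β : K') = star j' * j' ∧ X.q c = x.scal * β + k ∧
      (γ (T.ofVec X c)).scal = star (γ x).scal * h.centerEquiv β + h.centerEquiv k := by
  obtain ⟨β, hβ⟩ := h.centerEquiv.surjective (X'.norm (star j'))
  replace hβ : (h.centerEquiv β : K') = star j' * j' := by simp [hβ]
  have hvec : (γ (T.ofVec X c)).vec = ((γ x).smul j').vec := by
    rw [T.vec_smul, h.vec_map, h.vec_map, T.vec_ofVec, ho.map_eq]
  obtain ⟨k, hk⟩ := h.centerEquiv.surjective ⟨_, T.scal_sub_scal_mem hvec⟩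
  have hj : star j' * (γ x).scal * j' = star (γ x).scal * (star j' * j') := by
    rw [mul_assoc, ← ho.skew.eq, ← mul_assoc, ← hβ, h.central' _ (h.centerEquiv β).2]
  have hscal : (γ (T.ofVec X c)).scal =
      star (γ x).scal * h.centerEquiv β + h.centerEquiv k := by
    simp [hk, hβ, hj]
  refine ⟨β, k, hβ, op_injective (smul_left_injective _ ho.vec_ne_zero (h.vecEquiv.injective ?_)),
    hscal⟩
  have hc := h.vecEquiv_smul_scal (T.ofVec X c)
  rw [hscal, T.scal_ofVec, T.vec_ofVec] at hc
  simp only [op_add, add_smul, op_smul_mul, map_add, h.vecEquiv_smul, ho.vecEquiv_smul_scal]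
  simpa only [op_add, add_smul, op_smul_mul] using hc

theorem star_q_ne (ho : h.IsObstruction x j' c) : star (X.q c) ≠ X.q c := by
  obtain ⟨β, k, hβ, hq, -⟩ := ho.exists_scal_eq
  have hβ0 : (β : K) ≠ 0 := by
    rintro h0
    rw [ZeroMemClass.coe_eq_zero] at h0
    simp [h0, ho.ne_zero] at hβ
  rw [hq, star_add, star_mul, X.star_eq k k.2, X.star_eq β β.2, h.central β β.2, ne_eq,
    add_left_inj, mul_left_inj' hβ0]
  exact ho.star_ne

theorem f_map_eq_zero_of_orthogonal (ho : h.IsObstruction x j' c) {d : L} (had : X.f x.vec d = 0)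
    (hcd : X.f c d = 0) : X'.f (h.vecEquiv x.vec) (h.vecEquiv d) = 0 := by
  obtain ⟨β, k, -, -, hscal⟩ := ho.exists_scal_eq
  set s := (γ x).scal
  set u := X'.f (h.vecEquiv x.vec) (h.vecEquiv d)
  set y := T.ofVec X c
  set w := X'.f (h.vecEquiv c) (h.vecEquiv d)
  have hu : SemiconjBy u (star s) s :=
    (h.semiconjBy_f_iff ho.star_ne).2 (had ▸ SemiconjBy.zero_left _ _)
  have hw : SemiconjBy w (star (γ y).scal) (γ y).scal :=
    (h.semiconjBy_f_iff (x := y) ho.star_q_ne).2 (hcd.symm ▸ SemiconjBy.zero_left _ _)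
  have hwu : w = -j' * u := by
    rw [← h.central'.star_eq_neg_of_semiconjBy (h.star_scal_ne ho.star_ne) ho.skew,
      ← X'.f_smul_left, ← ho.map_eq]
  have hws : Commute w (star s) := h.central'.commute_star <| by
    rw [hwu]
    exact ho.skew.neg_left.mul_left (h.central'.semiconjBy_symm hu)
  have hwy : Commute w (γ y).scal := by
    rw [hscal]
    exact (hws.mul_right (h.central' _ (Subtype.prop _) w).symm).add_right
      (h.central' _ (Subtype.prop _) w).symm
  have hw0 : w = 0 := by
    by_contra hw0
    exact h.star_scal_ne ho.star_q_ne (mul_left_cancel₀ hw0 (hw.eq.trans hwy.symm.eq))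
  simpa [hw0, ho.ne_zero] using hwu.symm

theorem eq_zero_of_orthogonal (ho : h.IsObstruction x j' c) {d : L} (had : X.f x.vec d = 0)
    (hcd : X.f c d = 0) : d = 0 := by
  by_contra hd
  obtain ⟨β, k, hβ, hq, hscal⟩ := ho.exists_scal_eq
  have had' := ho.f_map_eq_zero_of_orthogonal had hcd
  have hcd' : X'.f (h.vecEquiv c) (h.vecEquiv d) = 0 := by
    rw [ho.map_eq, X'.f_smul_left, had', mul_zero]
  have hdx := h.vecEquiv_smul_scal_of_f_eq_zero had had'
  have hdc := h.vecEquiv_smul_scal_of_f_eq_zero (x := T.ofVec X c) hcd hcd'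
  have hβ0 : (h.centerEquiv β : K') ≠ 0 := by simp [hβ, ho.ne_zero]
  simp only [T.scal_ofVec, hq, hscal, op_add, add_smul, op_smul_mul, map_add, h.vecEquiv_smul, hdx,
    add_left_inj] at hdc
  rw [← op_smul_mul, ← op_smul_mul] at hdc
  exact h.star_scal_ne ho.star_ne (mul_right_cancel₀ hβ0
    (op_injective (smul_left_injective _ (h.vecEquiv.map_ne_zero_iff.2 hd) hdc))).symm

theorem false_of_ringEquiv (ho : h.IsObstruction x j' c) (ψ : K ≃+* K')
    (hψ : ∀ k : X.K₀, (h.centerEquiv k : K') = ψ k) : False := by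
  obtain ⟨β, k, hβ, hq, -⟩ := ho.exists_scal_eq
  have hj' := h.central'.star_eq_neg_of_semiconjBy (h.star_scal_ne ho.star_ne) ho.skew
  have hT : ψ (x.scal + star x.scal) = (γ x).scal + star (γ x).scal := by
    rw [← InvolutorySet.coe_trace (S := X.toInvolutorySet), ← hψ, h.centerEquiv_trace]
    rfl
  have hN : ψ (x.scal * star x.scal) = (γ x).scal * star (γ x).scal := by
    rw [← InvolutorySet.coe_norm (S := X.toInvolutorySet), ← hψ, h.centerEquiv_norm]
    rfl
  have hii : ψ.symm j' * ψ.symm j' = -β := by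
    rw [← map_mul, ψ.symm_apply_eq, map_neg, ← hψ, hβ, hj', neg_mul, neg_neg]
  obtain ⟨i, hi, hiβ⟩ := h.central.exists_semiconjBy_mul_self_eq (τ := ψ.symm (γ x).scal)
    (i := ψ.symm j') ho.star_ne (ψ.injective (by simp [hT, hN, h.central'.star_mul_self]))
    (by simpa using ho.ne_zero) (ψ.injective (by simp [hT, ho.skew.eq])) (hii ▸ neg_mem β.2)
  rw [hii] at hiβ
  have hscal : (x.smul i * T.ofVec X c).scal = (x.scal + star x.scal) * β + k := by
    have hfc : X.f c (x.vec <• i) = 0 := by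
      rw [X.f_smul_right, ← neg_eq_zero, ← neg_mul, ← X.star_f, ho.f_eq_zero, star_zero, zero_mul]
    rw [T.scal_mul, T.vec_ofVec, T.vec_smul, hfc, T.scal_smul, T.scal_ofVec, hq, add_zero,
      h.central.star_eq_neg_of_semiconjBy ho.star_ne hi]
    linear_combination (norm := noncomm_ring)
      -(h.central.semiconjBy_symm hi).eq * i - star x.scal * hiβ
  have hvec : x.vec <• i + c = 0 := T.vec_eq_zero_of_scal_mem
    (hscal ▸ add_mem (h.mul_mem (X.trace x.scal).2 β.2) k.2 : (x.smul i * T.ofVec X c).scal ∈ X.K₀)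
  have hfi := congrArg (X.f x.vec) hvec
  rw [X.f_add_right, X.f_smul_right, ho.f_eq_zero, X.f_zero_right, add_zero] at hfi
  have hi0 := (mul_eq_zero.1 hfi).resolve_left (T.f_self_ne_zero ho.star_ne)
  rw [hi0, mul_zero, eq_comm, neg_eq_zero, ZeroMemClass.coe_eq_zero] at hiβ
  simp [hiβ, ho.ne_zero] at hβ

theorem f_skew_eq_zero (ho : h.IsObstruction x j' c) {i : K}
    (hi : SemiconjBy i (star x.scal) x.scal) :
    X'.f (h.vecEquiv x.vec) (h.vecEquiv (x.vec <• i)) = 0 := by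
  by_contra hf
  obtain ⟨i', hi', hφi⟩ := h.exists_semiconjBy_vecEquiv_smul_eq ho.star_ne hi hf
  have hi0 : i' ≠ 0 := by
    rintro rfl
    simp [hφi, X'.f_zero_right] at hf
  have hw : Commute (i'⁻¹ * j') (γ x).scal :=
    (SemiconjBy.inv_symm_left₀ (h.central'.semiconjBy_symm hi')).mul_left
      (h.central'.semiconjBy_symm ho.skew)
  obtain ⟨k', l', hkl⟩ := h.central'.exists_eq_add_mul_of_commute (h.star_scal_ne ho.star_ne) hw
  obtain ⟨k, rfl⟩ := h.centerEquiv.surjective k'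
  obtain ⟨l, rfl⟩ := h.centerEquiv.surjective l'
  have hj' : j' = i' * (h.centerEquiv k + (γ x).scal * h.centerEquiv l) := by
    rw [← h.central' _ (h.centerEquiv l).2, ← hkl, mul_inv_cancel_left₀ hi0]
  have hc : c = x.vec <• (i * (k + x.scal * l)) := h.vecEquiv.injective <| by
    simp only [ho.map_eq, hj', op_smul_mul, ← hφi, op_add, add_smul, map_add, h.vecEquiv_smul,
      h.vecEquiv_skew_smul_scal_of_f_ne_zero ho.star_ne hi hf]
  have hfc := ho.f_eq_zero
  rw [hc, X.f_smul_right] at hfc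
  rw [(mul_eq_zero.1 hfc).resolve_left (T.f_self_ne_zero ho.star_ne), op_zero, zero_smul] at hc
  exact ho.vec_ne_zero hc

theorem eq_zero_of_forall_skew_eq_zero (ho : h.IsObstruction x j' c)
    (hskew : ∀ w, SemiconjBy w (star x.scal) x.scal → w = 0) {d' : L'}
    (hd' : X'.f (h.vecEquiv x.vec) d' = 0) : d' = 0 := by
  obtain ⟨d, rfl⟩ := h.vecEquiv.surjective d'
  have had : X.f x.vec d = 0 :=
    hskew _ ((h.semiconjBy_f_iff ho.star_ne).1 (hd'.symm ▸ SemiconjBy.zero_left _ _))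
  have hfc (z : K') : X'.f (h.vecEquiv c <• z) (h.vecEquiv d) = 0 := by
    rw [ho.map_eq, X'.f_smul_left, X'.f_smul_left, hd', mul_zero, mul_zero]
  have hcd : X.f c d = 0 := by
    refine hskew _ ((h.central.semiconjBy_star_iff ho.star_ne).2 ⟨?_, ?_⟩)
    · rw [← map_eq_zero_iff _ h.centerEquiv.injective, h.centerEquiv_trace_f]
      exact Subtype.ext (by simpa using congrArg (fun z => z + star z) (hfc 1))
    · rw [← X.f_smul_left, ← map_eq_zero_iff _ h.centerEquiv.injective, h.centerEquiv_trace_f,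
        ho.vecEquiv_smul_scal, hfc]
      exact Subtype.ext (by simp)
  rw [ho.eq_zero_of_orthogonal had hcd, map_zero]

theorem rank_eq_two {h : IsCentralJordanIso γ} {x : X.T} {j' : K'} {c : L}
    (ho : h.IsObstruction x j' c) : Module.rank Kᵐᵒᵖ L = 2 :=
  (rank_le_two_of_forall_f_eq_zero (T.f_self_ne_zero ho.star_ne)
    (T.f_self_ne_zero (x := T.ofVec X c) ho.star_q_ne) ho.f_eq_zero
    fun _ => ho.eq_zero_of_orthogonal).antisymm <|
  Cardinal.two_le_iff_one_lt.2 <|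
    one_lt_rank_of_f_eq_zero (T.f_self_ne_zero ho.star_ne) ho.vec_ne_zero ho.f_eq_zero

end IsObstruction

theorem isObstruction_symm (h : IsCentralJordanIso γ) {x : X.T} (hx : star x.scal ≠ x.scal) {i : K}
    (hi0 : i ≠ 0) (hi : SemiconjBy i (star x.scal) x.scal)
    (hf : X'.f (h.vecEquiv x.vec) (h.vecEquiv (x.vec <• i)) = 0) :
    h.symm.IsObstruction (γ x) i (h.vecEquiv (x.vec <• i)) where
  star_ne := h.star_scal_ne hx
  ne_zero := hi0
  skew := by rwa [γ.symm_apply_apply]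
  map_eq := by rw [h.symm_vecEquiv, h.vec_map, AddEquiv.symm_apply_apply, AddEquiv.symm_apply_apply]
  f_eq_zero := by rwa [h.vec_map]

theorem IsObstruction.exists_of_symm {h : IsCentralJordanIso γ} {y : X'.T} {j : K} {c' : L'}
    (ho : h.symm.IsObstruction y j c') {i : K'} (hi0 : i ≠ 0)
    (hi : SemiconjBy i (star y.scal) y.scal) : ∃ x j' c, h.IsObstruction x j' c :=
  ⟨_, _, _, h.symm.isObstruction_symm ho.star_ne hi0 hi (ho.f_skew_eq_zero hi)⟩

theorem exists_vecEquiv_smul_eq_skew_smul (h : IsCentralJordanIso γ) {x : X.T}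
    (hx : star x.scal ≠ x.scal) (hno : ∀ j' c, ¬ h.IsObstruction x j' c) {j' : K'}
    (hj' : SemiconjBy j' (star (γ x).scal) (γ x).scal) :
    ∃ j : K, h.vecEquiv (x.vec <• j) = h.vecEquiv x.vec <• j' := by
  rcases eq_or_ne j' 0 with rfl | hj0
  · exact ⟨0, by simp⟩
  have hf : X.f x.vec (h.vecEquiv.symm (h.vecEquiv x.vec <• j')) ≠ 0 := fun hf =>
    hno j' _ ⟨hx, hj0, hj', h.vecEquiv.apply_symm_apply _, hf⟩
  obtain ⟨j, -, hj⟩ := h.symm.exists_semiconjBy_vecEquiv_smul_eq (h.star_scal_ne hx) hj'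
    (by rwa [h.symm_vecEquiv, h.vec_map, AddEquiv.symm_apply_apply])
  rw [h.symm_vecEquiv, h.vec_map, AddEquiv.symm_apply_apply, AddEquiv.symm_apply_eq] at hj
  exact ⟨j, hj.symm⟩

theorem f_eq_zero_of_f_eq_zero (h : IsCentralJordanIso γ) {x : X.T} (hx : star x.scal ≠ x.scal)
    (hno : ∀ j' c, ¬ h.IsObstruction x j' c) {b : L} (hb : X.f x.vec b = 0) :
    X'.f (h.vecEquiv x.vec) (h.vecEquiv b) = 0 := by
  have hs := h.star_scal_ne hx
  have hu := (h.semiconjBy_f_iff hx).2 (hb.symm ▸ SemiconjBy.zero_left _ _)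
  set s := (γ x).scal
  set u := X'.f (h.vecEquiv x.vec) (h.vecEquiv b)
  have hanti {j' : K'} (hj' : SemiconjBy j' (star s) s) : j' * u + u * j' = 0 := by
    obtain ⟨j, hj⟩ := h.exists_vecEquiv_smul_eq_skew_smul hx hno hj'
    have htr := h.centerEquiv_trace_f (x.vec <• j) b
    have h0 : X.trace 0 = 0 := Subtype.ext (by simp)
    rw [X.f_smul_left, hb, mul_zero, h0, map_zero, hj, X'.f_smul_left,
      h.central'.star_eq_neg_of_semiconjBy hs hj'] at htr
    change 0 = X'.trace (-j' * u) at htr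
    have hju := congrArg Subtype.val htr
    rw [InvolutorySet.coe_trace, star_mul, star_neg, h.central'.star_eq_neg_of_semiconjBy hs hj',
      h.central'.star_eq_neg_of_semiconjBy hs hu, ZeroMemClass.coe_zero] at hju
    linear_combination (norm := noncomm_ring) hju
  have hsu : SemiconjBy (s * u) (star s) s := SemiconjBy.mul_left (Commute.refl s) hu
  have huu : (s - star s) * (u * u) = 0 := by
    linear_combination (norm := noncomm_ring)
      s * hanti hu - hanti hsu + (h.central'.semiconjBy_symm hu).eq * u
  simpa [sub_eq_zero, hs.symm] using huu

theorem vecEquiv_smul_scal_of_forall_not_isObstruction (h : IsCentralJordanIso γ) {x : X.T}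
    (hx : star x.scal ≠ x.scal) (hno : ∀ j' c, ¬ h.IsObstruction x j' c)
    (hno' : ∀ j c, ¬ h.symm.IsObstruction (γ x) j c) (b : L) :
    h.vecEquiv (b <• x.scal) = h.vecEquiv b <• (γ x).scal := by
  obtain ⟨w, j, hwj, hw, hj⟩ := h.central.exists_commute_add_semiconjBy hx
    ((X.f x.vec x.vec)⁻¹ * X.f x.vec b)
  have hb₀ : X.f x.vec (b - x.vec <• (w + j)) = 0 :=
    hwj ▸ f_sub_smul_inv_mul_f (T.f_self_ne_zero hx) b
  have hφb₀ := h.vecEquiv_smul_scal_of_f_eq_zero hb₀ (h.f_eq_zero_of_f_eq_zero hx hno hb₀)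
  have hφj : h.vecEquiv (x.vec <• j <• x.scal) = h.vecEquiv (x.vec <• j) <• (γ x).scal := by
    rcases eq_or_ne j 0 with rfl | hj0
    · simp
    · exact h.vecEquiv_skew_smul_scal_of_f_ne_zero hx hj fun hf =>
        hno' _ _ (h.isObstruction_symm hx hj0 hj hf)
  have hb : b = (b - x.vec <• (w + j)) + (x.vec <• w + x.vec <• j) := by
    rw [← add_smul, ← op_add, sub_add_cancel]
  rw [hb]
  simp only [smul_add, map_add, hφb₀, hφj, h.vecEquiv_smul_smul_scal_of_commute hx hw]

theorem exists_iso_of_forall_not_isObstruction (h : IsCentralJordanIso γ)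
    (hno : ∀ x j' c, ¬ h.IsObstruction x j' c) (hno' : ∀ y j c, ¬ h.symm.IsObstruction y j c) :
    ∃ Φ : Iso X X', Φ.Induces γ := by
  have hφ {x : X.T} (hx : star x.scal ≠ x.scal) (b : L) :
      h.vecEquiv (b <• x.scal) = h.vecEquiv b <• (γ x).scal :=
    h.vecEquiv_smul_scal_of_forall_not_isObstruction hx (hno x) (hno' _) b
  have := h.proper'.nontrivial
  obtain ⟨x, hx⟩ := exists_star_scal_ne h.proper
  obtain ⟨ϕ, hϕ⟩ := exists_ringHom_of_map_fst_intertwiners_eq_top h.vecEquiv <|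
    h.central.eq_top_of_forall_star_mul_mul_mem h.coe_K₀_subset_map_fst_intertwiners hx fun c => by
      rcases eq_or_ne c 0 with rfl | hc
      · simp
      · have hxc : star (x.smul c).scal ≠ (x.smul c).scal := by
          simpa [mul_assoc, hc] using hx
        exact ⟨(_, (γ (x.smul c)).scal), hφ hxc, rfl⟩
  refine h.exists_iso ϕ hϕ fun y => ?_
  by_cases hy : y.vec = 0
  · obtain ⟨k, rfl⟩ : ∃ k, y = T.ofK₀ k := ⟨⟨_, T.scal_mem_of_vec_eq_zero hy⟩, T.ext hy rfl⟩
    exact h.coe_centerEquiv_eq hϕ k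
  · exact op_injective (smul_left_injective _ (h.vecEquiv.map_ne_zero_iff.2 hy)
      ((h.vecEquiv_smul_scal y).symm.trans (hϕ _ _)))

theorem exists_iso_of_three_le_rank (h : IsCentralJordanIso γ) (hr : 3 ≤ Module.rank Kᵐᵒᵖ L) :
    ∃ Φ : Iso X X', Φ.Induces γ := by
  have hno x j' c : ¬ h.IsObstruction x j' c := fun ho => by
    rw [ho.rank_eq_two] at hr
    norm_num at hr
  refine h.exists_iso_of_forall_not_isObstruction hno fun y j c' ho => ?_
  by_cases hskew : ∀ i, SemiconjBy i (star y.scal) y.scal → i = 0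
  · have hr1 : Module.rank Kᵐᵒᵖ L ≤ 1 := rank_le_one_of_forall_f_eq_zero
      (a := h.symm.vecEquiv y.vec) (by
        rw [← h.symm.vec_map]
        exact T.f_self_ne_zero (h.symm.star_scal_ne ho.star_ne))
      fun d => ho.eq_zero_of_forall_skew_eq_zero hskew
    have h31 := hr.trans hr1
    norm_num at h31
  · push Not at hskew
    obtain ⟨i, hi, hi0⟩ := hskew
    obtain ⟨x, j', c, ho'⟩ := ho.exists_of_symm hi0 hi
    exact hno x j' c ho'

theorem exists_iso_of_ringEquiv (h : IsCentralJordanIso γ) (ψ : K ≃+* K')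
    (hψ : (¬ ∀ x y : K, x * y = y * x) → Module.rank Kᵐᵒᵖ L = 2 →
      ∀ k : X.K₀, (h.centerEquiv k : K') = ψ k) : ∃ Φ : Iso X X', Φ.Induces γ := by
  by_cases hK : ∀ x y : K, x * y = y * x
  · have hK' (x y : K') : x * y = y * x := ψ.symm.injective (by rw [map_mul, map_mul, hK])
    exact h.exists_iso_of_forall_not_isObstruction
      (fun x j' c ho => ho.ne_zero
        (eq_zero_of_semiconjBy_star hK' (h.star_scal_ne ho.star_ne) ho.skew))
      fun y j c' ho => ho.ne_zero
        (eq_zero_of_semiconjBy_star hK (h.symm.star_scal_ne ho.star_ne) ho.skew)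
  · have hno x j' c (ho : h.IsObstruction x j' c) : False :=
      ho.false_of_ringEquiv ψ (hψ hK ho.rank_eq_two)
    refine h.exists_iso_of_forall_not_isObstruction hno fun y j c' ho => ?_
    obtain ⟨i, hi, hi0⟩ : ∃ i, SemiconjBy i (star y.scal) y.scal ∧ i ≠ 0 := by
      by_contra! hskew
      refine hK fun x y => ψ.injective ?_
      rw [map_mul, map_mul, h.central'.mul_comm_of_forall_semiconjBy_eq_zero ho.star_ne hskew]
    obtain ⟨x, j', c, ho'⟩ := ho.exists_of_symm hi0 hi
    exact hno x j' c ho'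

end IsCentralJordanIso

theorem IsProperJordanIso.exists_iso_of_three_le_rank (h : IsProperJordanIso γ)
    (hr : 3 ≤ Module.rank Kᵐᵒᵖ L) : ∃ Φ : Iso X X', Φ.Induces γ := by
  by_cases hgen : Subring.closure (X.K₀ : Set K) = ⊤
  · exact h.exists_iso_of_isProperInvolutorySet ⟨h.proper.star_ne, hgen⟩
  have hmin : ¬ X.toInvolutorySet.IsMinimal := fun hmin => by
    have h31 := hr.trans (rank_le_one_of_isMinimal h.proper hmin)
    norm_num at h31
  exact IsCentralJordanIso.exists_iso_of_three_le_rank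
    ⟨h, X.isCentral_of_closure_ne_top hgen, hmin⟩ hr

theorem IsProperJordanIso.exists_iso_of_ringEquiv (h : IsProperJordanIso γ) (ψ : K ≃+* K')
    (hψ : (¬ ∀ x y : K, x * y = y * x) → Module.rank Kᵐᵒᵖ L = 2 →
      ∀ k : X.K₀, (h.centerEquiv k : K') = ψ k)
    (hF : IsEmpty (K ≃+* GaloisField 2 2)) : ∃ Φ : Iso X X', Φ.Induces γ := by
  by_cases hgen : Subring.closure (X.K₀ : Set K) = ⊤
  · exact h.exists_iso_of_isProperInvolutorySet ⟨h.proper.star_ne, hgen⟩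
  have hmin : ¬ X.toInvolutorySet.IsMinimal := fun hmin => by
    obtain ⟨t, ht⟩ := h.proper.star_ne
    exact not_nonempty_iff.2 hF (hmin.nonempty_ringEquiv_galoisField ht)
  exact IsCentralJordanIso.exists_iso_of_ringEquiv
    ⟨h, X.isCentral_of_closure_ne_top hgen, hmin⟩ ψ hψ

end PseudoQuadraticSpace

theorem mainTheorem6_general
    {K L K' L' : Type*}
    [DivisionRing K] [StarRing K] [AddCommGroup L] [Module Kᵐᵒᵖ L]
    [DivisionRing K'] [StarRing K'] [AddCommGroup L'] [Module K'ᵐᵒᵖ L']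
    (X : PseudoQuadraticSpace K L) (X' : PseudoQuadraticSpace K' L')
    (hX : X.IsProper) (hX' : X'.IsProper)
    (γ : X.T ≃* X'.T) (hγ : PseudoQuadraticSpace.IsJordanIso γ)
    (h : Subring.closure (X.K₀ : Set K) = ⊤ ∨ 3 ≤ Module.rank Kᵐᵒᵖ L ∨
      ((∃ ψ : K ≃+* K',
          (¬ ∀ x y : K, x * y = y * x) → Module.rank Kᵐᵒᵖ L = 2 →
            ∀ t : X.K₀, (γ (.ofK₀ t)).scal = ψ t) ∧
        IsEmpty (K ≃+* GaloisField 2 2))) :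
    ∃ Φ : PseudoQuadraticSpace.Iso X X', Φ.Induces γ := by
  have hp : PseudoQuadraticSpace.IsProperJordanIso γ := ⟨hX, hX', hγ⟩
  rcases h with hgen | hr | ⟨⟨ψ, hψ⟩, hF⟩
  · exact hp.exists_iso_of_isProperInvolutorySet ⟨hX.star_ne, hgen⟩
  · exact hp.exists_iso_of_three_le_rank hr
  · exact hp.exists_iso_of_ringEquiv ψ hψ hF

theorem mainTheorem6
    {K L K' L' : Type*}
    [DivisionRing K] [StarRing K] [AddCommGroup L] [Module Kᵐᵒᵖ L]
    [DivisionRing K'] [StarRing K'] [AddCommGroup L'] [Module K'ᵐᵒᵖ L']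
    (X : PseudoQuadraticSpace K L) (X' : PseudoQuadraticSpace K' L')
    (hX : X.IsProper) (hX' : X'.IsProper)
    (γ : X.T ≃* X'.T) (hγ : PseudoQuadraticSpace.IsJordanIso γ)
    (h : X.toInvolutorySet.IsProperInvolutorySet ∨
      ((X.toInvolutorySet.IsQuadraticOfTypeIII ∨ X.toInvolutorySet.IsQuadraticOfTypeIV) ∧
        3 ≤ Module.rank Kᵐᵒᵖ L) ∨
      ((X.toInvolutorySet.IsQuadraticOfTypeIII ∨ X.toInvolutorySet.IsQuadraticOfTypeIV) ∧
        Module.rank Kᵐᵒᵖ L ≤ 2 ∧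
        (∃ ψ : K ≃+* K',
          X.toInvolutorySet.IsQuadraticOfTypeIV → Module.rank Kᵐᵒᵖ L = 2 →
            ∀ t : X.K₀, (γ (.ofK₀ t)).scal = ψ t) ∧
        IsEmpty (K ≃+* GaloisField 2 2))) :
    ∃ Φ : PseudoQuadraticSpace.Iso X X', Φ.Induces γ :=
  mainTheorem6_general X X' hX hX' γ hγ <| h.imp And.right <| Or.imp And.right
    fun ⟨hq, _, ⟨ψ, hψ⟩, hF⟩ => ⟨⟨ψ, fun hK => hψ (hq.resolve_left fun hIII => hK hIII.1)⟩, hF⟩
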